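/- **Setting.** For each sample size $n$ let $Y = X\theta^* + Z\gamma^* + w$, with $X\in\mathbb R^{n}$, $Z\in\mathbb R^{n\times p}$, $\theta^*\in\mathbb R$, $\gamma^*\in\mathbb R^p$ and $w\sim N(0,\sigma^2 I_n)$ independent of $(X,Z)$, where $\sigma>0$ is fixed and $p,\theta^*,\gamma^*$ and the law of the design may depend on $n$. The vector $\gamma^*$ has at most $s\ge 1$ nonzero entries and $\|\gamma^*\|_1\le\bar\rho$. The rows $U^i=(X^i,Z^i)$ are i.i.d. with mean zero and $\mathbb E\,e^{U^i h}\le e^{C_0\|h\|^2/2}$ for all $h\in\mathbb R^{1+p}$; $\Sigma_{Z,Z}=\mathbb E[(Z^i)^TZ^i]$ is invertible, and $\alpha^*=\Sigma_{Z,Z}^{-1}\mathbb E[(Z^i)^TX^i]$ satisfies $\|\alpha^*\|_1\le A$. **Estimators.** Let $\alpha\in\arg\min_{a}\{\frac1{2n}\|X-Za\|^2+\lambda_1\|a\|_1\}$ be a measurable function of $(X,Z)$, and put $\widetilde X=X-Z\alpha$. The CLasso algorithm starts at a Lasso solution $(\theta^0,\gamma^0)\in\arg\min_{\theta,\gamma}\{\frac1{2n}\|Y-X\theta-Z\gamma\|^2+\lambda|\theta|+\lambda\|\gamma\|_1\}$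 and iterates $\theta^{t}=(\widetilde X^TX)^{-1}\widetilde X^T(Y-Z\gamma^{t-1})$, $\gamma^{t}\in\arg\min_\gamma\{\frac1{2n}\|Y-X\theta^{t}-Z\gamma\|^2+\lambda_t\|\gamma\|_1\}$, where the $\lambda_t$ may depend on the data. (The $\lambda_1$ that defines $\alpha$ is unrelated to the $\lambda_t$ of the iteration.) The de-sparsified Lasso estimator is $$\widehat b_1=\theta^0+\widehat\tau_1^{-2}\,(X-Z\alpha)^T(Y-X\theta^0-Z\gamma^0)/n,\qquad \widehat\tau_1^2=\tfrac1n\|X-Z\alpha\|^2+2\lambda_1\|\alpha\|_1 .$$ **Assumptions.** There are constants $\mu>0$ and $C$, and sequences $\tau,\nu$ with $\nu\le(2C)^{-1}$, such that with probability tending to one: $\frac1n\|Zu\|^2\ge\mu\|u\|^2$ for all $u$ with $\|u_{S^c}\|_1\le3\|u_S\|_1$, where $S=\mathrm{supp}(\gamma^*)$; $n^{-1}\|\widetilde X\|^2$ is positive, and it and its inverse are at most $C$; $\|n^{-1}\widetilde X^TZ\|_\infty\le\tau$; $|n^{-1}\widetilde X^TZ\alpha|\le\nu$; $n^{-1}\|X\|^2\le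 C$ and $\max_j n^{-1}\|Z_j\|^2\le C$. For all large $n$, $\lambda\ge2\sigma\sqrt{2C\log p/n}+4\sigma C^2/\sqrt n+8C\bar\rho\,\tau$; moreover $\lambda=O(\sqrt{\log p/n})$, $\lambda_1=O(\sqrt{\log p/n})$ and, for all large $n$, $\lambda_1\ge D_0\sqrt{\log p/n}$. **Proposition 1.** For all $C_0,A$ there is a constant $D_0>0$, depending only on $(C_0,A)$, such that under the assumptions above, as $n\to\infty$, $p\to\infty$ and $\sqrt{s/n}\,\log p\to0$, $$|\theta^1-\widehat b_1|=O_P\Big(\frac{\sqrt s\,\log p}{n}\Big).$$ If in addition $s\log p/\sqrt n\to0$, then $\sqrt s\,\log p/n=o_P(|\widehat b_1-\theta^*|)$, and $|\theta^1-\widehat b_1|=o_P(|\widehat b_1-\theta^*|)$, so that $\theta^1$ and $\widehat b_1$ are asymptotically equivalent. -/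

import Mathlib

open Filter Topology MeasureTheory ProbabilityTheory Asymptotics
open scoped Matrix ENNReal

namespace CLasso

noncomputable section

/-- A design with `n` rows. The row `i` is `(Xⁱ, Zⁱ)`, where `Xⁱ : ℝ` is the covariate of interest
(dimension one) and `Zⁱ` is the vector of the `p` nuisance covariates. -/
abbrev Design (n p : ℕ) : Type := Fin n → ℝ × (Fin p → ℝ)

/-- The column `X` of interest. -/
def colX {n p : ℕ} (U : Design n p) : Fin n → ℝ := fun i => (U i).1

/-- The nuisance design matrix `Z`. -/
def matZ {n p : ℕ} (U : Design n p) : Matrix (Fin n) (Fin p) ℝ := Matrix.of fun i j => (U i).2 j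

/-- Squared Euclidean norm of a real vector. -/
def sqNorm {ι : Type*} [Fintype ι] (v : ι → ℝ) : ℝ := ∑ i, v i ^ 2

/-- The `ℓ₁` norm of a real vector. -/
def l1Norm {ι : Type*} [Fintype ι] (v : ι → ℝ) : ℝ := ∑ i, |v i|

/-- The support of a vector. -/
def supp {p : ℕ} (g : Fin p → ℝ) : Finset (Fin p) := {j | g j ≠ 0}

/-- The residual vector `X - Z a`. -/
def residX {n p : ℕ} (U : Design n p) (a : Fin p → ℝ) : Fin n → ℝ := colX U - matZ U *ᵥ a

/-- Objective of the node-wise regression of `X` on `Z`. -/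
def nodewiseObj {n p : ℕ} (U : Design n p) (lam : ℝ) (a : Fin p → ℝ) : ℝ :=
  1 / (2 * (n : ℝ)) * sqNorm (colX U - matZ U *ᵥ a) + lam * l1Norm a

/-- Objective of the (unadjusted) Lasso of `Y` on `(X, Z)`, at `b = (θ, γ)`. -/
def lassoObj {n p : ℕ} (U : Design n p) (Y : Fin n → ℝ) (lam : ℝ) (b : ℝ × (Fin p → ℝ)) : ℝ :=
  1 / (2 * (n : ℝ)) * sqNorm (Y - b.1 • colX U - matZ U *ᵥ b.2) + lam * |b.1| + lam * l1Norm b.2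

/-- Objective of the Lasso of the partial residual `Y - X θ` on `Z`. -/
def partialLassoObj {n p : ℕ} (U : Design n p) (Y : Fin n → ℝ) (lam th : ℝ)
    (g : Fin p → ℝ) : ℝ :=
  1 / (2 * (n : ℝ)) * sqNorm (Y - th • colX U - matZ U *ᵥ g) + lam * l1Norm g

/-- The sequences `θ⁰, θ¹, …` and `γ⁰, γ¹, …` are produced by the CLasso algorithm on the data
`(Y, X, Z)`, with node-wise regularization `lam1`, Lasso regularization `lam` and regularization
`lamt t` in the update of `γ` at step `t`. Every `argmin` is an arbitrary minimizer. -/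
structure IsRun {n p : ℕ} (U : Design n p) (Y : Fin n → ℝ) (lam1 lam : ℝ) (lamt : ℕ → ℝ)
    (alpha : Fin p → ℝ) (th : ℕ → ℝ) (ga : ℕ → Fin p → ℝ) : Prop where
  nodewise : IsMinOn (nodewiseObj U lam1) Set.univ alpha
  init : IsMinOn (lassoObj U Y lam) Set.univ (th 0, ga 0)
  theta_step : ∀ t : ℕ, th (t + 1) =
    (residX U alpha ⬝ᵥ colX U)⁻¹ * (residX U alpha ⬝ᵥ (Y - matZ U *ᵥ ga t))
  gamma_step : ∀ t : ℕ,
    IsMinOn (partialLassoObj U Y (lamt (t + 1)) (th (t + 1))) Set.univ (ga (t + 1))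

/-- `τ̂₁²`, the normalization of the de-sparsified Lasso. -/
def tauHatSq {n p : ℕ} (U : Design n p) (lam1 : ℝ) (alpha : Fin p → ℝ) : ℝ :=
  1 / (n : ℝ) * sqNorm (residX U alpha) + 2 * lam1 * l1Norm alpha

/-- The first row of the relaxed inverse of `n⁻¹ Uᵀ U`, namely `τ̂₁⁻² (1, - α₁ᵀ)`. -/
def relaxedInverseRow {n p : ℕ} (U : Design n p) (lam1 : ℝ) (alpha : Fin p → ℝ) :
    ℝ × (Fin p → ℝ) :=
  ((tauHatSq U lam1 alpha)⁻¹, -((tauHatSq U lam1 alpha)⁻¹ • alpha))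

/-- The first coordinate of the de-sparsified Lasso `β̂ + Θ̂ Uᵀ (Y - U β̂) / n`, where
`β̂ = (th0, ga0)` is the Lasso. -/
def deSparsified {n p : ℕ} (U : Design n p) (Y : Fin n → ℝ) (lam1 : ℝ) (alpha : Fin p → ℝ)
    (th0 : ℝ) (ga0 : Fin p → ℝ) : ℝ :=
  th0 + ((relaxedInverseRow U lam1 alpha).1 * (colX U ⬝ᵥ (Y - th0 • colX U - matZ U *ᵥ ga0)) +
    (relaxedInverseRow U lam1 alpha).2 ⬝ᵥ
      ((matZ U)ᵀ *ᵥ (Y - th0 • colX U - matZ U *ᵥ ga0))) / (n : ℝ)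

/-- Restricted eigenvalue condition with constant `mu` over the cone
`{u : ‖u_{Sᶜ}‖₁ ≤ 3 ‖u_S‖₁}`. -/
def REC {n p : ℕ} (Z : Matrix (Fin n) (Fin p) ℝ) (S : Finset (Fin p)) (mu : ℝ) : Prop :=
  ∀ u : Fin p → ℝ, ∑ j ∈ Sᶜ, |u j| ≤ 3 * ∑ j ∈ S, |u j| →
    mu * sqNorm u ≤ 1 / (n : ℝ) * sqNorm (Z *ᵥ u)

/-- The conditions on the design and on `α` (with a one-dimensional `X`, where the Gram matrix of
`X - Z α` is a number and all its matrix norms are its absolute value). -/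
structure DesignConditions {n p : ℕ} (U : Design n p) (alpha gammaStar : Fin p → ℝ)
    (mu C tau nu : ℝ) : Prop where
  rec_cond : REC (matZ U) (supp gammaStar) mu
  gram_pos : 0 < 1 / (n : ℝ) * sqNorm (residX U alpha)
  gram_inv_le : (1 / (n : ℝ) * sqNorm (residX U alpha))⁻¹ ≤ C
  gram_le : 1 / (n : ℝ) * sqNorm (residX U alpha) ≤ C
  cross_le : ∀ j : Fin p, |1 / (n : ℝ) * ((matZ U)ᵀ *ᵥ residX U alpha) j| ≤ tau
  cross_alpha_le : |1 / (n : ℝ) * (residX U alpha ⬝ᵥ (matZ U *ᵥ alpha))| ≤ nu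
  colX_le : 1 / (n : ℝ) * sqNorm (colX U) ≤ C
  colZ_le : ∀ j : Fin p, 1 / (n : ℝ) * sqNorm (fun i => matZ U i j) ≤ C

/-- A row distribution has mean zero and sub-Gaussian tails with constant `C0`. -/
structure SubGaussianRow {p : ℕ} (Q : Measure (ℝ × (Fin p → ℝ))) (C0 : ℝ) : Prop where
  mean_X : ∫ u, u.1 ∂Q = 0
  mean_Z : ∀ j : Fin p, ∫ u, u.2 j ∂Q = 0
  integrable_exp : ∀ (h0 : ℝ) (h : Fin p → ℝ),
    Integrable (fun u : ℝ × (Fin p → ℝ) => Real.exp (u.1 * h0 + u.2 ⬝ᵥ h)) Q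
  mgf_le : ∀ (h0 : ℝ) (h : Fin p → ℝ),
    ∫ u, Real.exp (u.1 * h0 + u.2 ⬝ᵥ h) ∂Q ≤ Real.exp (C0 / 2 * (h0 ^ 2 + sqNorm h))

/-- The population matrix `Σ_{Z,Z}`. -/
def sigmaZZ {p : ℕ} (Q : Measure (ℝ × (Fin p → ℝ))) : Matrix (Fin p) (Fin p) ℝ :=
  Matrix.of fun j k => ∫ u, u.2 j * u.2 k ∂Q

/-- The population vector `Σ_{Z,X}`. -/
def sigmaZX {p : ℕ} (Q : Measure (ℝ × (Fin p → ℝ))) : Fin p → ℝ :=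
  fun j => ∫ u, u.2 j * u.1 ∂Q

/-- The population coefficient `α* = Σ_{Z,Z}⁻¹ Σ_{Z,X}`. -/
def alphaStar {p : ℕ} (Q : Measure (ℝ × (Fin p → ℝ))) : Fin p → ℝ :=
  (sigmaZZ Q)⁻¹ *ᵥ sigmaZX Q

/-- The law `N(0, σ² Iₙ)`. -/
def noiseLaw (n : ℕ) (sigma : ℝ) : Measure (Fin n → ℝ) :=
  Measure.pi fun _ => gaussianReal 0 (sigma ^ 2).toNNReal

/-- The response `Y = X θ* + Z γ* + w`. -/
def response {n p : ℕ} (U : Design n p) (thetaStar : ℝ) (gammaStar : Fin p → ℝ)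
    (w : Fin n → ℝ) : Fin n → ℝ :=
  thetaStar • colX U + matZ U *ᵥ gammaStar + w

/-- `V n = O_P(r n)` for a deterministic rate `r`. -/
def IsBigOP {Ω : ℕ → Type*} [∀ n, MeasurableSpace (Ω n)] (P : ∀ n, Measure (Ω n))
    (V : ∀ n, Ω n → ℝ) (r : ℕ → ℝ) : Prop :=
  ∀ ε : ℝ≥0∞, 0 < ε → ∃ M : ℝ, ∀ᶠ n in atTop, P n {ω | M * r n < |V n ω|} ≤ ε

/-- `V n = o_P(|R n|)` for a random `R`. -/
def IsLittleOP {Ω : ℕ → Type*} [∀ n, MeasurableSpace (Ω n)] (P : ∀ n, Measure (Ω n))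
    (V R : ∀ n, Ω n → ℝ) : Prop :=
  ∀ ε : ℝ, 0 < ε → Tendsto (fun n => P n {ω | ε * |R n ω| < |V n ω|}) atTop (𝓝 0)

end

end CLasso

/-!
Write `X̃ = X - Z α`, `G = n⁻¹ ‖X̃‖²`, `L = λ₁ ‖α‖₁`, `l = √(log p / n)`, and let
`r = Y - X θ⁰ - Z γ⁰` be the residual of the initial Lasso.

Optimality of `α` under rescaling gives `n⁻¹ X̃ᵀ Z α = L` (`nodewise_score_self`). Hence both
estimators are one-step corrections of `θ⁰` by the same score `R = n⁻¹ X̃ᵀ r`, with different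
normalizations: `θ¹ = θ⁰ + R / (G + L)` and `b = θ⁰ + R / (G + 2 L)`. The optimality conditions of the
initial Lasso bound `R` by `λ (1 + ‖α‖₁)`, so `|θ¹ - b|` is at most `C² L λ (1 + ‖α‖₁)`
(`IsRun.abs_theta_one_sub_le`). This is of order `l²` once `‖α‖₁` is bounded, which is at least as
good as the claimed rate `√s l²`.

The bound `‖α‖₁ ≤ 3 A` follows from the basic inequality of the node-wise Lasso, compared with the
population coefficient `α*`, when the score `n⁻¹ Zᵀ (X - Z α*)` is at most `λ₁ / 2`. The entries of
this score are averages of centred products of sub-Gaussian variables, for which a Bernstein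
inequality (`measure_abs_sum_ge_le`) and a union bound apply; this determines the constant `D₀`.

For the lower bound on `|b - θ*|`, the de-sparsified Lasso is linearized
(`tauHatSq_mul_deSparsified_sub`):
`(G + 2 L) (b - θ*) = n⁻¹ X̃ᵀ w + L (θ⁰ - θ*) - n⁻¹ X̃ᵀ Z (γ⁰ - γ*)`. The last two terms are
`O(s l²)` by the rates of the initial Lasso (`exists_lasso_rate`), and
`s l² = (s log p / √n) n^{-1/2} = o(n^{-1/2})` under the stronger sparsity assumption. Given the
design, `n⁻¹ X̃ᵀ w` is a centred Gaussian variable whose standard deviation is at least a multiple of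
`n^{-1/2}`, so it exceeds any `o(n^{-1/2})` sequence with probability tending to one
(`measure_noise_small_ball_le`).

In the rates of the Lasso, the restricted eigenvalue condition concerns `Z` only, with the cone
constant `3`, whereas the error `δ = θ⁰ - θ*` perturbs the cone condition of `u = γ⁰ - γ*` by
`4 |δ|`. The condition tolerates such an additive violation (`REC.sqrt_sum_sq_le`), and `δ` itself is
controlled by `l` and `λ₁ ‖u‖₁` through the score along `X̃`; since `√s l → 0`, these inequalities can
be solved (`exists_rate_bound`).
-/

namespace CLasso

/-! ### Norms of vectors -/

section Norms

variable {ι : Type*} [Fintype ι]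

lemma sqNorm_eq_dotProduct (v : ι → ℝ) : sqNorm v = v ⬝ᵥ v := by
  simp [sqNorm, dotProduct, sq]

lemma sqNorm_nonneg (v : ι → ℝ) : 0 ≤ sqNorm v :=
  Finset.sum_nonneg fun _ _ => sq_nonneg _

lemma l1Norm_nonneg (v : ι → ℝ) : 0 ≤ l1Norm v :=
  Finset.sum_nonneg fun _ _ => abs_nonneg _

lemma sqNorm_sub (r e : ι → ℝ) : sqNorm (r - e) = sqNorm r - 2 * (r ⬝ᵥ e) + sqNorm e := by
  simp only [sqNorm_eq_dotProduct, sub_dotProduct, dotProduct_sub, dotProduct_comm e r]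
  ring

lemma sqNorm_sub_smul (r x : ι → ℝ) (t : ℝ) :
    sqNorm (r - t • x) = sqNorm r - 2 * t * (x ⬝ᵥ r) + t ^ 2 * sqNorm x := by
  rw [sqNorm_sub]
  simp only [sqNorm_eq_dotProduct, dotProduct_smul, smul_dotProduct, smul_eq_mul,
    dotProduct_comm r x]
  ring

lemma l1Norm_add_le (v e : ι → ℝ) : l1Norm (v + e) ≤ l1Norm v + l1Norm e := by
  unfold l1Norm
  rw [← Finset.sum_add_distrib]
  exact Finset.sum_le_sum fun i _ => abs_add_le _ _

lemma l1Norm_smul (t : ℝ) (v : ι → ℝ) : l1Norm (t • v) = |t| * l1Norm v := by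
  simp [l1Norm, abs_mul, Finset.mul_sum]

lemma l1Norm_single [DecidableEq ι] (j : ι) (t : ℝ) : l1Norm (Pi.single j t) = |t| := by
  unfold l1Norm
  rw [Finset.sum_eq_single j] <;> simp +contextual

lemma sqNorm_le_l1Norm_sq (v : ι → ℝ) : sqNorm v ≤ l1Norm v ^ 2 := by
  have h := Finset.sum_sq_le_sq_sum_of_nonneg (s := Finset.univ) (f := fun i => |v i|)
    fun i _ => abs_nonneg _
  simpa [sqNorm, l1Norm, sq_abs] using h

lemma abs_dotProduct_le {a b : ι → ℝ} {B : ℝ} (h : ∀ j, |a j| ≤ B) :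
    |a ⬝ᵥ b| ≤ B * l1Norm b := by
  unfold dotProduct l1Norm
  rw [Finset.mul_sum]
  refine (Finset.abs_sum_le_sum_abs _ _).trans (Finset.sum_le_sum fun j _ => ?_)
  rw [abs_mul]
  exact mul_le_mul_of_nonneg_right (h j) (abs_nonneg _)

/-- The empirical norm `(n⁻¹ ‖v‖²)^{1/2}` of a vector with `n` coordinates. -/
noncomputable def empNorm {n : ℕ} (v : Fin n → ℝ) : ℝ := √(1 / (n : ℝ) * sqNorm v)

variable {n : ℕ}

lemma empNorm_nonneg (v : Fin n → ℝ) : 0 ≤ empNorm v := Real.sqrt_nonneg _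

lemma empNorm_sq (v : Fin n → ℝ) : empNorm v ^ 2 = 1 / (n : ℝ) * sqNorm v :=
  Real.sq_sqrt (mul_nonneg (by positivity) (sqNorm_nonneg v))

lemma empNorm_eq (v : Fin n → ℝ) :
    empNorm v = √(1 / (n : ℝ)) * ‖(WithLp.toLp 2 v : EuclideanSpace ℝ (Fin n))‖ := by
  unfold empNorm
  rw [Real.sqrt_mul (by positivity)]
  simp [EuclideanSpace.norm_eq, sqNorm]

lemma empNorm_add_le (v e : Fin n → ℝ) : empNorm (v + e) ≤ empNorm v + empNorm e := by
  simp only [empNorm_eq, WithLp.toLp_add, ← mul_add]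
  exact mul_le_mul_of_nonneg_left (norm_add_le _ _) (Real.sqrt_nonneg _)

lemma empNorm_smul (t : ℝ) (v : Fin n → ℝ) : empNorm (t • v) = |t| * empNorm v := by
  simp only [empNorm_eq, WithLp.toLp_smul, norm_smul, Real.norm_eq_abs]
  ring

lemma empNorm_sum_le {κ : Type*} (s : Finset κ) (f : κ → Fin n → ℝ) :
    empNorm (∑ j ∈ s, f j) ≤ ∑ j ∈ s, empNorm (f j) := by
  simp only [empNorm_eq, WithLp.toLp_sum, ← Finset.mul_sum]
  exact mul_le_mul_of_nonneg_left (norm_sum_le _ _) (Real.sqrt_nonneg _)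

lemma empNorm_mulVec_le {p : ℕ} {Z : Matrix (Fin n) (Fin p) ℝ} {B : ℝ}
    (h : ∀ j, empNorm (fun i => Z i j) ≤ B) (u : Fin p → ℝ) :
    empNorm (Z *ᵥ u) ≤ B * l1Norm u := by
  have : Z *ᵥ u = ∑ j, u j • (fun i => Z i j) := by
    ext i
    simp [Matrix.mulVec, dotProduct, mul_comm]
  rw [this, l1Norm, Finset.mul_sum]
  refine (empNorm_sum_le _ _).trans (Finset.sum_le_sum fun j _ => ?_)
  rw [empNorm_smul, mul_comm]
  exact mul_le_mul_of_nonneg_right (h j) (abs_nonneg _)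

end Norms

/-! ### Optimality conditions -/

section Optimality

/-- First-order condition: a linear term dominated by a quadratic one for small `ε > 0` has a
nonpositive slope. -/
lemma nonpos_of_forall_mul_le_sq_mul {k d : ℝ} (h : ∀ ε : ℝ, 0 < ε → ε ≤ 1 → ε * k ≤ ε ^ 2 * d) :
    k ≤ 0 := by
  have h1 : Tendsto (fun ε : ℝ => ε * d) (𝓝[>] 0) (𝓝 0) := by
    have : Tendsto (fun ε : ℝ => ε * d) (𝓝 0) (𝓝 (0 * d)) :=
      (by fun_prop : Continuous fun ε : ℝ => ε * d).tendsto 0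
    rw [zero_mul] at this
    exact this.mono_left nhdsWithin_le_nhds
  refine ge_of_tendsto h1 ?_
  filter_upwards [Ioc_mem_nhdsGT (show (0 : ℝ) < 1 by norm_num)] with ε hε
  have := h ε hε.1 hε.2
  nlinarith [hε.1]

/-- One-dimensional optimality condition: if moving along `x` by `t` can decrease the quadratic
loss of the residual `r` by at most `lam * |t|`, then the score of `r` along `x` is at most
`lam`. -/
lemma abs_score_le {n : ℕ} {r x : Fin n → ℝ} {lam : ℝ}
    (h : ∀ t : ℝ, 1 / (2 * (n : ℝ)) * sqNorm r ≤
      1 / (2 * (n : ℝ)) * sqNorm (r - t • x) + lam * |t|) :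
    |1 / (n : ℝ) * (x ⬝ᵥ r)| ≤ lam := by
  have h2 : (1 : ℝ) / (2 * (n : ℝ)) = 1 / (n : ℝ) / 2 := by ring
  rw [abs_le]
  constructor
  · have : -(1 / (n : ℝ) * (x ⬝ᵥ r)) - lam ≤ 0 := by
      refine nonpos_of_forall_mul_le_sq_mul (d := 1 / (2 * (n : ℝ)) * sqNorm x) fun ε hε _ => ?_
      have h1 := h (-ε)
      rw [sqNorm_sub_smul, abs_neg, abs_of_pos hε, h2] at h1
      rw [h2]
      linear_combination h1
    linarith
  · have : 1 / (n : ℝ) * (x ⬝ᵥ r) - lam ≤ 0 := by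
      refine nonpos_of_forall_mul_le_sq_mul (d := 1 / (2 * (n : ℝ)) * sqNorm x) fun ε hε _ => ?_
      have h1 := h ε
      rw [sqNorm_sub_smul, abs_of_pos hε, h2] at h1
      rw [h2]
      linear_combination h1
    linarith

variable {n p : ℕ} {U : Design n p}

lemma matZ_mulVec_single (j : Fin p) (t : ℝ) :
    matZ U *ᵥ Pi.single j t = t • fun i => matZ U i j := by
  ext i
  simp [mul_comm]

lemma dotProduct_mulVec_eq (U : Design n p) (v : Fin n → ℝ) (u : Fin p → ℝ) :
    1 / (n : ℝ) * (v ⬝ᵥ (matZ U *ᵥ u)) =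
      (fun j => 1 / (n : ℝ) * ((matZ U)ᵀ *ᵥ v) j) ⬝ᵥ u := by
  rw [Matrix.dotProduct_mulVec, ← Matrix.mulVec_transpose]
  change _ = ((1 / (n : ℝ)) • ((matZ U)ᵀ *ᵥ v)) ⬝ᵥ _
  rw [smul_dotProduct, smul_eq_mul]

lemma residX_dotProduct_colX (U : Design n p) (alpha : Fin p → ℝ) :
    residX U alpha ⬝ᵥ colX U =
      sqNorm (residX U alpha) + residX U alpha ⬝ᵥ (matZ U *ᵥ alpha) := by
  rw [sqNorm_eq_dotProduct, ← dotProduct_add]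
  simp [residX]

lemma nodewise_score_le {lam1 : ℝ} {alpha : Fin p → ℝ} (hlam : 0 ≤ lam1)
    (h : IsMinOn (nodewiseObj U lam1) Set.univ alpha) (j : Fin p) :
    |1 / (n : ℝ) * ((matZ U)ᵀ *ᵥ residX U alpha) j| ≤ lam1 := by
  change |1 / (n : ℝ) * ((fun i => matZ U i j) ⬝ᵥ residX U alpha)| ≤ lam1
  refine abs_score_le fun t => ?_
  have h1 := isMinOn_univ_iff.1 h (alpha + Pi.single j t)
  unfold nodewiseObj at h1
  rw [Matrix.mulVec_add, matZ_mulVec_single, ← sub_sub] at h1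
  have h2 := mul_le_mul_of_nonneg_left (l1Norm_add_le alpha (Pi.single j t)) hlam
  rw [l1Norm_single] at h2
  unfold residX
  linarith

/-- Optimality of the node-wise Lasso under rescaling. -/
lemma nodewise_score_self {lam1 : ℝ} {alpha : Fin p → ℝ}
    (h : IsMinOn (nodewiseObj U lam1) Set.univ alpha) :
    1 / (n : ℝ) * (residX U alpha ⬝ᵥ (matZ U *ᵥ alpha)) = lam1 * l1Norm alpha := by
  have h2 : (1 : ℝ) / (2 * (n : ℝ)) = 1 / (n : ℝ) / 2 := by ring
  set d := 1 / (2 * (n : ℝ)) * sqNorm (matZ U *ᵥ alpha)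
  have key : ∀ t : ℝ, |t| ≤ 1 →
      t * (1 / (n : ℝ) * (residX U alpha ⬝ᵥ (matZ U *ᵥ alpha)) - lam1 * l1Norm alpha) ≤
        t ^ 2 * d := by
    intro t ht
    have h1 := isMinOn_univ_iff.1 h ((1 + t) • alpha)
    unfold nodewiseObj at h1
    rw [l1Norm_smul, abs_of_nonneg (by linarith [(abs_le.1 ht).1] : 0 ≤ 1 + t), add_smul, one_smul,
      Matrix.mulVec_add, Matrix.mulVec_smul, ← sub_sub] at h1
    change 1 / (2 * (n : ℝ)) * sqNorm (residX U alpha) + _ ≤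
      1 / (2 * (n : ℝ)) * sqNorm (residX U alpha - _) + _ at h1
    rw [sqNorm_sub_smul, dotProduct_comm, h2] at h1
    simp only [d, h2]
    linear_combination h1
  refine le_antisymm (sub_nonpos.1 ?_) (sub_nonneg.1 ?_)
  · exact nonpos_of_forall_mul_le_sq_mul fun ε hε h1 => key ε (by rwa [abs_of_pos hε])
  · rw [← neg_nonpos]
    refine nonpos_of_forall_mul_le_sq_mul (d := d) fun ε hε h1 => ?_
    have := key (-ε) (by rwa [abs_neg, abs_of_pos hε])
    linear_combination this

/-- If the score of `X - Z a` is at most half the regularization parameter for some `a`, then the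
node-wise Lasso has an `ℓ₁` norm of at most `3 ‖a‖₁`. -/
lemma l1Norm_nodewise_le {lam1 : ℝ} {alpha a : Fin p → ℝ} (hlam : 0 < lam1)
    (h : IsMinOn (nodewiseObj U lam1) Set.univ alpha)
    (ha : ∀ j, |1 / (n : ℝ) * ((matZ U)ᵀ *ᵥ residX U a) j| ≤ lam1 / 2) :
    l1Norm alpha ≤ 3 * l1Norm a := by
  have h1 := isMinOn_univ_iff.1 h a
  unfold nodewiseObj at h1
  have h2 : colX U - matZ U *ᵥ alpha = residX U a - matZ U *ᵥ (alpha - a) := by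
    unfold residX
    rw [Matrix.mulVec_sub]
    abel
  rw [h2, sqNorm_sub] at h1
  change _ ≤ 1 / (2 * (n : ℝ)) * sqNorm (residX U a) + _ at h1
  have h3 : |(fun j => 1 / (n : ℝ) * ((matZ U)ᵀ *ᵥ residX U a) j) ⬝ᵥ (alpha - a)| ≤
      lam1 / 2 * l1Norm (alpha - a) := abs_dotProduct_le ha
  rw [← dotProduct_mulVec_eq] at h3
  have h5 : l1Norm (alpha - a) ≤ l1Norm alpha + l1Norm a := by
    have := l1Norm_add_le alpha ((-1 : ℝ) • a)
    rw [l1Norm_smul] at this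
    simpa [sub_eq_add_neg] using this
  have h6 : 0 ≤ 1 / (2 * (n : ℝ)) * sqNorm (matZ U *ᵥ (alpha - a)) :=
    mul_nonneg (by positivity) (sqNorm_nonneg _)
  have h7 := (abs_le.1 h3).2
  have h8 : (1 : ℝ) / (2 * (n : ℝ)) = 1 / (n : ℝ) / 2 := by ring
  rw [h8] at h1 h6
  have h9 : lam1 / 2 * l1Norm (alpha - a) ≤ lam1 / 2 * (l1Norm alpha + l1Norm a) :=
    mul_le_mul_of_nonneg_left h5 (by positivity)
  have h10 : lam1 * l1Norm alpha ≤ lam1 * (3 * l1Norm a) := by linarith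
  exact le_of_mul_le_mul_left h10 hlam

variable {Y : Fin n → ℝ} {lam th0 : ℝ} {ga0 : Fin p → ℝ}

lemma lasso_score_colX_le (h : IsMinOn (lassoObj U Y lam) Set.univ (th0, ga0)) (hlam : 0 ≤ lam) :
    |1 / (n : ℝ) * (colX U ⬝ᵥ (Y - th0 • colX U - matZ U *ᵥ ga0))| ≤ lam := by
  refine abs_score_le fun t => ?_
  have h1 := isMinOn_univ_iff.1 h (th0 + t, ga0)
  unfold lassoObj at h1
  have h2 : Y - (th0 + t) • colX U - matZ U *ᵥ ga0 =
      Y - th0 • colX U - matZ U *ᵥ ga0 - t • colX U := by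
    rw [add_smul]; abel
  simp only [h2] at h1
  have := mul_le_mul_of_nonneg_left (abs_add_le th0 t) hlam
  linarith

lemma lasso_score_matZ_le (h : IsMinOn (lassoObj U Y lam) Set.univ (th0, ga0)) (hlam : 0 ≤ lam)
    (j : Fin p) :
    |1 / (n : ℝ) * ((matZ U)ᵀ *ᵥ (Y - th0 • colX U - matZ U *ᵥ ga0)) j| ≤ lam := by
  change |1 / (n : ℝ) * ((fun i => matZ U i j) ⬝ᵥ (Y - th0 • colX U - matZ U *ᵥ ga0))| ≤ lam
  refine abs_score_le fun t => ?_
  have h1 := isMinOn_univ_iff.1 h (th0, ga0 + Pi.single j t)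
  unfold lassoObj at h1
  simp only [Matrix.mulVec_add, matZ_mulVec_single, ← sub_sub] at h1
  have h2 := mul_le_mul_of_nonneg_left (l1Norm_add_le ga0 (Pi.single j t)) hlam
  rw [l1Norm_single] at h2
  linarith

/-- The score of the Lasso along the residual `X - Z α` is bounded by Hölder's inequality. -/
lemma lasso_score_residX_le (h : IsMinOn (lassoObj U Y lam) Set.univ (th0, ga0)) (hlam : 0 ≤ lam)
    (alpha : Fin p → ℝ) :
    |1 / (n : ℝ) * (residX U alpha ⬝ᵥ (Y - th0 • colX U - matZ U *ᵥ ga0))| ≤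
      lam * (1 + l1Norm alpha) := by
  set r := Y - th0 • colX U - matZ U *ᵥ ga0
  have h1 : |(fun j => 1 / (n : ℝ) * ((matZ U)ᵀ *ᵥ r) j) ⬝ᵥ alpha| ≤ lam * l1Norm alpha :=
    abs_dotProduct_le (lasso_score_matZ_le h hlam)
  rw [← dotProduct_mulVec_eq, dotProduct_comm r] at h1
  have h3 := lasso_score_colX_le h hlam
  have h4 : 1 / (n : ℝ) * (residX U alpha ⬝ᵥ r) =
      1 / (n : ℝ) * (colX U ⬝ᵥ r) - 1 / (n : ℝ) * ((matZ U *ᵥ alpha) ⬝ᵥ r) := by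
    unfold residX
    rw [sub_dotProduct]; ring
  rw [h4]
  refine (abs_sub _ _).trans ?_
  linarith

end Optimality

/-! ### Rates of convergence of the Lasso -/

section Rates

variable {n p : ℕ}

/-- The restricted eigenvalue condition still bounds `u_S` when the cone condition on `u` is
violated by at most `E`: shrinking `u_{Sᶜ}` brings `u` into the cone, at a cost of at most
`√C * E` in the empirical norm of `Z u`. -/
lemma REC.sqrt_sum_sq_le {Z : Matrix (Fin n) (Fin p) ℝ} {S : Finset (Fin p)} {mu C E : ℝ}
    (h : REC Z S mu) (hmu : 0 ≤ mu)
    (hcol : ∀ j, 1 / (n : ℝ) * sqNorm (fun i => Z i j) ≤ C) (hE : 0 ≤ E) {u : Fin p → ℝ}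
    (hu : ∑ j ∈ Sᶜ, |u j| ≤ 3 * ∑ j ∈ S, |u j| + E) :
    √mu * √(∑ j ∈ S, u j ^ 2) ≤ empNorm (Z *ᵥ u) + √C * E := by
  have ha : 0 ≤ ∑ j ∈ S, |u j| := Finset.sum_nonneg fun _ _ => abs_nonneg _
  have hb : 0 ≤ ∑ j ∈ Sᶜ, |u j| := Finset.sum_nonneg fun _ _ => abs_nonneg _
  -- the factor by which `u` is shrunk outside of `S`
  obtain ⟨t, ht0, ht1, ht, htE⟩ : ∃ t : ℝ, 0 ≤ t ∧ t ≤ 1 ∧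
      t * ∑ j ∈ Sᶜ, |u j| ≤ 3 * ∑ j ∈ S, |u j| ∧ (1 - t) * ∑ j ∈ Sᶜ, |u j| ≤ E := by
    by_cases hc : ∑ j ∈ Sᶜ, |u j| ≤ 3 * ∑ j ∈ S, |u j|
    · exact ⟨1, by simp, by simp, by simpa using hc, by simpa using hE⟩
    · push Not at hc
      have hb' : 0 < ∑ j ∈ Sᶜ, |u j| := by linarith
      refine ⟨3 * (∑ j ∈ S, |u j|) / ∑ j ∈ Sᶜ, |u j|, by positivity,
        (div_le_one hb').2 hc.le, ?_, ?_⟩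
      · rw [div_mul_cancel₀ _ hb'.ne']
      · rw [sub_mul, div_mul_cancel₀ _ hb'.ne']
        linarith
  set u' : Fin p → ℝ := fun j => if j ∈ S then u j else t * u j
  have hS : ∀ f : ℝ → ℝ, ∑ j ∈ S, f (u' j) = ∑ j ∈ S, f (u j) := fun f =>
    Finset.sum_congr rfl fun j hj => by simp [u', hj]
  have hS' : ∑ j ∈ Sᶜ, |u' j| = t * ∑ j ∈ Sᶜ, |u j| := by
    rw [Finset.mul_sum]
    refine Finset.sum_congr rfl fun j hj => ?_
    simp [u', Finset.mem_compl.1 hj, abs_mul, abs_of_nonneg ht0]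
  have h1 : mu * sqNorm u' ≤ 1 / (n : ℝ) * sqNorm (Z *ᵥ u') := by
    refine h u' ?_
    rw [hS', hS fun x => |x|]
    exact ht
  have h2 : ∑ j ∈ S, u j ^ 2 ≤ sqNorm u' := by
    rw [← hS fun x => x ^ 2]
    exact Finset.sum_le_sum_of_subset_of_nonneg (Finset.subset_univ _) fun _ _ _ => sq_nonneg _
  have h3 : l1Norm (u' - u) ≤ E := by
    have : l1Norm (u' - u) = (1 - t) * ∑ j ∈ Sᶜ, |u j| := by
      unfold l1Norm
      rw [← Finset.sum_add_sum_compl S, Finset.mul_sum, Finset.sum_eq_zero, zero_add]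
      · refine Finset.sum_congr rfl fun j hj => ?_
        have : t * u j - u j = -((1 - t) * u j) := by ring
        simp only [u', Pi.sub_apply, Finset.mem_compl.1 hj, if_false, this, abs_neg, abs_mul,
          abs_of_nonneg (sub_nonneg.2 ht1)]
      · intro j hj
        simp [u', hj]
    rw [this]; exact htE
  have h4 : empNorm (Z *ᵥ u') ≤ empNorm (Z *ᵥ u) + √C * E := by
    have : Z *ᵥ u' = Z *ᵥ u + Z *ᵥ (u' - u) := by
      rw [Matrix.mulVec_sub]; abel
    rw [this]
    refine (empNorm_add_le _ _).trans (add_le_add le_rfl ?_)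
    refine (empNorm_mulVec_le (B := √C) (fun j => Real.sqrt_le_sqrt (hcol j)) _).trans ?_
    exact mul_le_mul_of_nonneg_left h3 (Real.sqrt_nonneg _)
  refine le_trans ?_ h4
  rw [← Real.sqrt_mul hmu]
  exact Real.sqrt_le_sqrt ((mul_le_mul_of_nonneg_left h2 hmu).trans h1)

/-- The increase of the `ℓ₁` norm from a vector supported on `S`. -/
lemma l1Norm_sub_l1Norm_add_le (g u : Fin p → ℝ) :
    l1Norm g - l1Norm (g + u) ≤ ∑ j ∈ supp g, |u j| - ∑ j ∈ (supp g)ᶜ, |u j| := by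
  unfold l1Norm
  rw [← Finset.sum_add_sum_compl (supp g) (fun j => |g j|),
    ← Finset.sum_add_sum_compl (supp g) (fun j => |(g + u) j|)]
  have h1 : ∑ j ∈ (supp g)ᶜ, |g j| = 0 := Finset.sum_eq_zero fun j hj => by
    simpa [supp] using hj
  have h2 : ∑ j ∈ (supp g)ᶜ, |(g + u) j| = ∑ j ∈ (supp g)ᶜ, |u j| :=
    Finset.sum_congr rfl fun j hj => by
      have : g j = 0 := by simpa [supp] using hj
      simp [this]
  have h3 : ∑ j ∈ supp g, |g j| ≤ ∑ j ∈ supp g, |(g + u) j| + ∑ j ∈ supp g, |u j| := by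
    rw [← Finset.sum_add_distrib]
    refine Finset.sum_le_sum fun j _ => ?_
    have := abs_sub ((g + u) j) (u j)
    simpa using this
  linarith

lemma sum_abs_le_sqrt_card_mul (S : Finset (Fin p)) (u : Fin p → ℝ) {s : ℝ}
    (hs : (S.card : ℝ) ≤ s) : ∑ j ∈ S, |u j| ≤ √s * √(∑ j ∈ S, u j ^ 2) := by
  rw [← Real.sqrt_mul ((Nat.cast_nonneg _).trans hs)]
  refine Real.le_sqrt_of_sq_le ?_
  have := sq_sum_le_card_mul_sum_sq (s := S) (f := fun j => |u j|)
  simp only [sq_abs] at this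
  exact this.trans (mul_le_mul_of_nonneg_right hs (Finset.sum_nonneg fun _ _ => sq_nonneg _))

/-- The elementary inequalities behind the rates of the Lasso. Here `q` stands for the prediction
error, `y` for the `ℓ₂` norm on the support, `d` for the error of the coefficient of interest, `x`
for the square root of the sparsity and `l` for the rate `√(log p / n)`. -/
lemma exists_rate_bound {mu C K K1 : ℝ} (hmu : 0 < mu) (hK : 0 ≤ K) (hK1 : 0 ≤ K1) :
    ∃ η > 0, ∃ M ≥ 0, ∀ q y d x l : ℝ, 0 ≤ q → 0 ≤ y → 0 ≤ d → 1 ≤ x → 0 ≤ l → x * l ≤ η →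
      d ≤ K1 * l + K1 * l * (4 * x * y + 4 * d) →
      √mu * y ≤ q + 5 * √C * d →
      q ^ 2 ≤ 3 * K * l * x * y + 4 * K * l * d →
      y ≤ M * (x * l) ∧ d ≤ M * (x * l) := by
  have hm : 0 < √mu := Real.sqrt_pos.2 hmu
  -- `η` is chosen so that `e = 8 K₁ x l` satisfies `e ≤ 1` and `10 √C e ≤ √μ`
  set η : ℝ := min 1 (√mu / (10 * (√C + 1))) / (8 * (K1 + 1)) with hη
  have hη0 : 0 < η := by positivity
  have hη1 : 8 * (K1 + 1) * η ≤ 1 := by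
    rw [hη, mul_div_cancel₀ _ (by positivity)]; exact min_le_left _ _
  have hη2 : 8 * (K1 + 1) * η * (10 * (√C + 1)) ≤ √mu := by
    rw [hη, mul_div_cancel₀ _ (by positivity), ← le_div_iff₀ (by positivity)]
    exact min_le_right _ _
  set K2 : ℝ := 2 / √mu * (1 + 10 * √C * K1) with hK2
  have hK2' : 0 ≤ K2 := by positivity
  set K3 : ℝ := 3 * K * K2 + 4 * K * (2 * K1 + K2) with hK3
  have hK3' : 0 ≤ K3 := by positivity
  set M : ℝ := K2 * (K3 + 2) + 2 * K1 with hM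
  refine ⟨η, hη0, M, by positivity, ?_⟩
  intro q y d x l hq hy hd hx hl hxl h1 h2 h3
  set e := 8 * K1 * (x * l) with he
  have hxl0 : 0 ≤ x * l := by positivity
  have hlxl : l ≤ x * l := le_mul_of_one_le_left hl hx
  have he0 : 0 ≤ e := by positivity
  have hee : e ≤ 8 * (K1 + 1) * η := by
    rw [he]; gcongr; linarith
  have he1 : e ≤ 1 := hee.trans hη1
  have he2 : 10 * √C * e ≤ √mu := by
    refine le_trans ?_ hη2
    have := mul_le_mul hee (show 10 * √C ≤ 10 * (√C + 1) by linarith) (by positivity)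
      (by positivity)
    linarith
  have hd1 : d ≤ 2 * K1 * l + e * y := by
    have : K1 * l * (4 * d) ≤ e / 2 * d := by
      have := mul_le_mul_of_nonneg_left hlxl (show 0 ≤ 4 * K1 * d by positivity)
      rw [he]; linarith
    have h5 : e / 2 * d ≤ 1 / 2 * d := by gcongr
    have h6 : K1 * l * (4 * x * y) = e / 2 * y := by rw [he]; ring
    linarith
  have hy1 : y ≤ K2 * (q + x * l) := by
    have h5 : 5 * √C * d ≤ 10 * √C * K1 * (x * l) + √mu / 2 * y := by
      have h6 := mul_le_mul_of_nonneg_left hd1 (show 0 ≤ 5 * √C by positivity)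
      have h7 := mul_le_mul_of_nonneg_right he2 hy
      have h8 := mul_le_mul_of_nonneg_left hlxl (show 0 ≤ 10 * √C * K1 by positivity)
      linarith
    have h6 : √mu * y ≤ 2 * (q + 10 * √C * K1 * (x * l)) := by linarith
    have h7 : y ≤ 2 / √mu * (q + 10 * √C * K1 * (x * l)) := by
      rw [div_mul_eq_mul_div, le_div_iff₀ hm]; linarith
    refine h7.trans ?_
    have h9 : 0 ≤ 2 / √mu * (10 * √C * K1 * q + x * l) := by positivity
    rw [hK2]
    linarith
  have hd2 : d ≤ 2 * K1 * (x * l) + y := by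
    have := mul_le_mul_of_nonneg_right he1 hy
    have := mul_le_mul_of_nonneg_left hlxl (show 0 ≤ 2 * K1 by positivity)
    linarith
  have hq1 : q ^ 2 ≤ K3 * (x * l) * (q + x * l) := by
    have h5 : 3 * K * l * x * y ≤ 3 * K * K2 * (x * l) * (q + x * l) := by
      have := mul_le_mul_of_nonneg_left hy1 (show 0 ≤ 3 * K * (x * l) by positivity)
      linarith
    have h6 : 4 * K * l * d ≤ 4 * K * (2 * K1 + K2) * (x * l) * (q + x * l) := by
      have h7 : d ≤ (2 * K1 + K2) * (q + x * l) := by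
        have : 0 ≤ K1 * q := by positivity
        linarith
      have h8 : 4 * K * l ≤ 4 * K * (x * l) := by gcongr
      have := mul_le_mul h8 h7 hd (by positivity)
      linarith
    rw [hK3]; linarith
  have hq2 : q ≤ (K3 + 1) * (x * l) := by
    by_contra! hc'
    have h5 : (K3 + 1) * (x * l) * q ≤ q * q := mul_le_mul_of_nonneg_right hc'.le hq
    have h6 : 0 ≤ K3 * (x * l) := by positivity
    have hq0 : 0 < q := lt_of_le_of_lt (show 0 ≤ (K3 + 1) * (x * l) by positivity) hc'
    rcases hxl0.eq_or_lt with h0 | h0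
    · rw [← h0] at hq1
      nlinarith
    · have h7 : (x * l) * ((K3 + 1) * (x * l)) < (x * l) * q := mul_lt_mul_of_pos_left hc' h0
      nlinarith
  have hy2 : y ≤ K2 * (K3 + 2) * (x * l) := by
    refine hy1.trans ?_
    have := mul_le_mul_of_nonneg_left hq2 hK2'
    linarith
  have h0 : 0 ≤ K1 * (x * l) := by positivity
  rw [hM]
  constructor <;> linarith

lemma DesignConditions.one_le {U : Design n p} {alpha gammaStar : Fin p → ℝ} {mu C tau nu : ℝ}
    (h : DesignConditions U alpha gammaStar mu C tau nu) : 1 ≤ C := by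
  have h1 := h.gram_pos
  have h2 := h.gram_inv_le
  have h3 := h.gram_le
  by_contra! hC
  have := one_lt_inv_iff₀.2 ⟨h1, h3.trans_lt hC⟩
  linarith

lemma response_sub_eq (U : Design n p) (thetaStar : ℝ) (gammaStar : Fin p → ℝ) (w : Fin n → ℝ)
    (th0 : ℝ) (ga0 : Fin p → ℝ) :
    response U thetaStar gammaStar w - th0 • colX U - matZ U *ᵥ ga0 =
      w - ((th0 - thetaStar) • colX U + matZ U *ᵥ (ga0 - gammaStar)) := by
  unfold response
  rw [sub_smul, Matrix.mulVec_sub]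
  abel

/-- The score along the residual `X - Z α` of a response with coefficient errors `d` and `u`. -/
lemma residX_score_eq {U : Design n p} {lam1 : ℝ} {alpha : Fin p → ℝ}
    (h : IsMinOn (nodewiseObj U lam1) Set.univ alpha) (w : Fin n → ℝ) (d : ℝ) (u : Fin p → ℝ) :
    1 / (n : ℝ) * (residX U alpha ⬝ᵥ (w - (d • colX U + matZ U *ᵥ u))) =
      1 / (n : ℝ) * (residX U alpha ⬝ᵥ w) -
        (1 / (n : ℝ) * sqNorm (residX U alpha) + lam1 * l1Norm alpha) * d -
          1 / (n : ℝ) * (residX U alpha ⬝ᵥ (matZ U *ᵥ u)) := by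
  rw [← nodewise_score_self h]
  simp only [dotProduct_sub, dotProduct_add, dotProduct_smul, smul_eq_mul, residX_dotProduct_colX]
  ring

/-- The basic inequality of the Lasso. -/
lemma lasso_basic_inequality {U : Design n p} {w : Fin n → ℝ} {lam thetaStar th0 : ℝ}
    {gammaStar ga0 : Fin p → ℝ}
    (h : IsMinOn (lassoObj U (response U thetaStar gammaStar w) lam) Set.univ (th0, ga0))
    (hlam : 0 ≤ lam)
    (hwX : |1 / (n : ℝ) * (colX U ⬝ᵥ w)| ≤ lam)
    (hwZ : ∀ j, |1 / (n : ℝ) * ((matZ U)ᵀ *ᵥ w) j| ≤ lam / 2) :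
    empNorm ((th0 - thetaStar) • colX U + matZ U *ᵥ (ga0 - gammaStar)) ^ 2 ≤
      4 * lam * |th0 - thetaStar| + 3 * lam * ∑ j ∈ supp gammaStar, |(ga0 - gammaStar) j| -
        lam * ∑ j ∈ (supp gammaStar)ᶜ, |(ga0 - gammaStar) j| := by
  have h1 := isMinOn_univ_iff.1 h (thetaStar, gammaStar)
  unfold lassoObj at h1
  simp only [response_sub_eq, sub_self, zero_smul, Matrix.mulVec_zero, add_zero, sub_zero] at h1
  set u := ga0 - gammaStar with hu
  set d := th0 - thetaStar with hd
  rw [sqNorm_sub] at h1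
  rw [empNorm_sq]
  have h2 : (1 : ℝ) / (2 * (n : ℝ)) = 1 / (n : ℝ) / 2 := by ring
  rw [h2] at h1
  have h3 : 1 / (n : ℝ) * (w ⬝ᵥ (d • colX U + matZ U *ᵥ u)) ≤ lam * |d| + lam / 2 * l1Norm u := by
    rw [dotProduct_add, mul_add, dotProduct_mulVec_eq, dotProduct_smul, smul_eq_mul,
      dotProduct_comm w]
    refine add_le_add ?_ ((le_abs_self _).trans (abs_dotProduct_le hwZ))
    calc 1 / (n : ℝ) * (d * (colX U ⬝ᵥ w)) ≤ |1 / (n : ℝ) * (d * (colX U ⬝ᵥ w))| := le_abs_self _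
      _ = |1 / (n : ℝ) * (colX U ⬝ᵥ w)| * |d| := by rw [← abs_mul]; ring_nf
      _ ≤ lam * |d| := mul_le_mul_of_nonneg_right hwX (abs_nonneg _)
  have h4 := mul_le_mul_of_nonneg_left (l1Norm_sub_l1Norm_add_le gammaStar u) hlam
  have h5 : gammaStar + u = ga0 := by simp [hu]
  rw [h5] at h4
  have h6 : lam * (|thetaStar| - |th0|) ≤ lam * |d| := by
    refine mul_le_mul_of_nonneg_left ?_ hlam
    rw [hd, abs_sub_comm]
    exact abs_sub_abs_le_abs_sub _ _
  have h7 : l1Norm u = ∑ j ∈ supp gammaStar, |u j| + ∑ j ∈ (supp gammaStar)ᶜ, |u j| :=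
    (Finset.sum_add_sum_compl _ _).symm
  rw [h7] at h3
  linarith

/-- Rates of convergence of the Lasso: `O(√s l)` for the coefficient of interest and `O(s l)` for
the `ℓ₁` error of the nuisance coefficients, where `l` plays the role of `√(log p / n)`. The
restricted eigenvalue condition concerns `Z` only, and the coefficient of interest is controlled
through its score along `X - Z α`. -/
lemma exists_lasso_rate {mu : ℝ} (hmu : 0 < mu) {C K a : ℝ} (hC : 1 ≤ C) (hK : 0 ≤ K)
    (ha : 0 ≤ a) :
    ∃ η > 0, ∃ M ≥ 0, ∀ (n p : ℕ) (U : Design n p) (w : Fin n → ℝ) (thetaStar th0 : ℝ)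
      (gammaStar ga0 alpha : Fin p → ℝ) (lam lam1 tau nu s l : ℝ),
      DesignConditions U alpha gammaStar mu C tau nu → l1Norm alpha ≤ a →
      0 ≤ l → 0 < lam → lam ≤ K * l → 0 ≤ lam1 → lam1 ≤ K * l →
      1 ≤ s → ((supp gammaStar).card : ℝ) ≤ s → √s * l ≤ η →
      |1 / (n : ℝ) * (colX U ⬝ᵥ w)| ≤ lam →
      (∀ j, |1 / (n : ℝ) * ((matZ U)ᵀ *ᵥ w) j| ≤ lam / 2) →
      |1 / (n : ℝ) * (residX U alpha ⬝ᵥ w)| ≤ l →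
      IsMinOn (nodewiseObj U lam1) Set.univ alpha →
      IsMinOn (lassoObj U (response U thetaStar gammaStar w) lam) Set.univ (th0, ga0) →
      |th0 - thetaStar| ≤ M * (√s * l) ∧ l1Norm (ga0 - gammaStar) ≤ M * (s * l) := by
  have hC0 : 0 ≤ C := zero_le_one.trans hC
  set K1 : ℝ := C * (K * (1 + a) + 1 + K) with hK1
  have hK1' : 0 ≤ K1 := by positivity
  obtain ⟨η, hη, M, hM, key⟩ := exists_rate_bound (C := C) hmu hK hK1'
  refine ⟨η, hη, 8 * M, by positivity, ?_⟩
  intro n p U w thetaStar th0 gammaStar ga0 alpha lam lam1 tau nu s l hD hα hl hlam hlamK hlam1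
    hlam1K hs hcard hsl hwX hwZ hwR hnode hlasso
  have hbasic := lasso_basic_inequality hlasso hlam.le hwX hwZ
  have hscore := lasso_score_residX_le hlasso hlam.le alpha
  rw [response_sub_eq] at hscore
  set u := ga0 - gammaStar with hu
  set d := th0 - thetaStar with hd
  set y := √(∑ j ∈ supp gammaStar, u j ^ 2) with hy
  set q := empNorm (d • colX U + matZ U *ᵥ u) with hq
  have hx1 : 1 ≤ √s := Real.one_le_sqrt.2 hs
  have hSy : ∑ j ∈ supp gammaStar, |u j| ≤ √s * y := sum_abs_le_sqrt_card_mul _ _ hcard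
  have hq2 : 0 ≤ q ^ 2 := sq_nonneg _
  have hcone : ∑ j ∈ (supp gammaStar)ᶜ, |u j| ≤ 3 * ∑ j ∈ supp gammaStar, |u j| + 4 * |d| := by
    refine le_of_mul_le_mul_left (a := lam) ?_ hlam
    linarith
  have hl1 : l1Norm u ≤ 4 * √s * y + 4 * |d| := by
    have : l1Norm u = ∑ j ∈ supp gammaStar, |u j| + ∑ j ∈ (supp gammaStar)ᶜ, |u j| :=
      (Finset.sum_add_sum_compl _ _).symm
    linarith
  have hcompl : 0 ≤ ∑ j ∈ (supp gammaStar)ᶜ, |u j| := Finset.sum_nonneg fun _ _ => abs_nonneg _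
  have hl1' : 0 ≤ l1Norm u := l1Norm_nonneg u
  -- the coefficient of interest, through the score along the residual of the node-wise regression
  have hdl : |d| ≤ K1 * l + K1 * l * (4 * √s * y + 4 * |d|) := by
    set G := 1 / (n : ℝ) * sqNorm (residX U alpha) with hG
    rw [residX_score_eq hnode] at hscore
    have h3 : |1 / (n : ℝ) * (residX U alpha ⬝ᵥ (matZ U *ᵥ u))| ≤ lam1 * l1Norm u := by
      rw [dotProduct_mulVec_eq]
      exact abs_dotProduct_le (nodewise_score_le hlam1 hnode)
    have h4 : |(G + lam1 * l1Norm alpha) * d| ≤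
        lam * (1 + l1Norm alpha) + l + lam1 * l1Norm u := by
      rw [abs_le] at hscore hwR h3 ⊢
      constructor <;> linarith
    have hGpos : 0 < G := hD.gram_pos
    have hL : 0 ≤ lam1 * l1Norm alpha := mul_nonneg hlam1 (l1Norm_nonneg _)
    rw [abs_mul, abs_of_nonneg (by linarith)] at h4
    have h5 : |d| ≤ C * (G * |d|) := by
      have h6 : 1 ≤ C * G := by
        have := mul_le_mul_of_nonneg_right hD.gram_inv_le hGpos.le
        rwa [inv_mul_cancel₀ hGpos.ne'] at this
      have := mul_le_mul_of_nonneg_right h6 (abs_nonneg d)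
      linarith
    have h6 : G * |d| ≤ K * l * (1 + a) + l + K * l * l1Norm u := by
      have h7 : lam * (1 + l1Norm alpha) ≤ K * l * (1 + a) :=
        mul_le_mul hlamK (by linarith) (by linarith [l1Norm_nonneg alpha]) (by positivity)
      have h8 : lam1 * l1Norm u ≤ K * l * l1Norm u := mul_le_mul_of_nonneg_right hlam1K hl1'
      have h9 := mul_nonneg hL (abs_nonneg d)
      linarith
    have h7 : |d| ≤ C * (K * l * (1 + a) + l + K * l * l1Norm u) :=
      h5.trans (mul_le_mul_of_nonneg_left h6 hC0)
    have h8 : C * (K * l * (1 + a) + l) ≤ K1 * l := by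
      have : 0 ≤ C * K * l := by positivity
      rw [hK1]; linarith
    have h9 : C * (K * l * l1Norm u) ≤ K1 * l * (4 * √s * y + 4 * |d|) := by
      have h10 : C * (K * l) ≤ K1 * l := by
        have : 0 ≤ C * (K * (1 + a) + 1) * l := by positivity
        rw [hK1]; linarith
      have := mul_le_mul h10 hl1 hl1' (by positivity)
      linarith
    linarith
  have hyq : √mu * y ≤ q + 5 * √C * |d| := by
    have h1 := hD.rec_cond.sqrt_sum_sq_le hmu.le hD.colZ_le (E := 4 * |d|) (by positivity) hcone
    have h2 : empNorm (matZ U *ᵥ u) ≤ q + √C * |d| := by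
      have h3 : matZ U *ᵥ u = (d • colX U + matZ U *ᵥ u) + (-d) • colX U := by
        rw [neg_smul]; abel
      rw [h3]
      refine (empNorm_add_le _ _).trans (add_le_add le_rfl ?_)
      rw [empNorm_smul, abs_neg, mul_comm]
      exact mul_le_mul_of_nonneg_right (Real.sqrt_le_sqrt hD.colX_le) (abs_nonneg _)
    linarith
  have hqb : q ^ 2 ≤ 3 * K * l * √s * y + 4 * K * l * |d| := by
    have h1 : 3 * lam * ∑ j ∈ supp gammaStar, |u j| ≤ 3 * (K * l) * (√s * y) :=
      mul_le_mul (by linarith) hSy (Finset.sum_nonneg fun _ _ => abs_nonneg _) (by positivity)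
    have h2 : 4 * lam * |d| ≤ 4 * (K * l) * |d| :=
      mul_le_mul_of_nonneg_right (by linarith) (abs_nonneg _)
    have h3 := mul_nonneg hlam.le hcompl
    linarith
  obtain ⟨h1, h2⟩ := key q y |d| √s l (empNorm_nonneg _) (Real.sqrt_nonneg _) (abs_nonneg _) hx1 hl
    hsl hdl hyq hqb
  have hss : √s * √s = s := Real.mul_self_sqrt (by linarith)
  have hsl0 : 0 ≤ M * (√s * l) := by positivity
  refine ⟨by linarith, hl1.trans ?_⟩
  have hsM : M * (s * l) = √s * (M * (√s * l)) := by linear_combination (-(M * l)) * hss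
  have h3 := mul_le_mul_of_nonneg_left h1 (show 0 ≤ 4 * √s by positivity)
  have h4 := mul_le_mul_of_nonneg_right hx1 hsl0
  linarith

end Rates

/-! ### The CLasso step and the de-sparsified Lasso -/

section Comparison

variable {n p : ℕ} {U : Design n p} {Y : Fin n → ℝ} {lam1 lam : ℝ} {lamt : ℕ → ℝ}
  {alpha : Fin p → ℝ} {th : ℕ → ℝ} {ga : ℕ → Fin p → ℝ}

lemma deSparsified_eq (th0 : ℝ) (ga0 : Fin p → ℝ) :
    deSparsified U Y lam1 alpha th0 ga0 = th0 + (tauHatSq U lam1 alpha)⁻¹ *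
      (1 / (n : ℝ) * (residX U alpha ⬝ᵥ (Y - th0 • colX U - matZ U *ᵥ ga0))) := by
  set r := Y - th0 • colX U - matZ U *ᵥ ga0 with hr
  have h : alpha ⬝ᵥ ((matZ U)ᵀ *ᵥ r) = (matZ U *ᵥ alpha) ⬝ᵥ r := by
    rw [Matrix.mulVec_transpose, dotProduct_comm, ← Matrix.dotProduct_mulVec, dotProduct_comm]
  simp only [deSparsified, relaxedInverseRow, ← hr, neg_dotProduct, smul_dotProduct, smul_eq_mul, h,
    residX, sub_dotProduct]
  ring

/-- The first CLasso step has the form of the de-sparsified Lasso, with normalization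
`n⁻¹ ‖X - Z α‖² + λ₁ ‖α‖₁`. -/
lemma IsRun.theta_one_eq (h : IsRun U Y lam1 lam lamt alpha th ga) (hn : 0 < n)
    (hG : 0 < 1 / (n : ℝ) * sqNorm (residX U alpha)) (hlam1 : 0 ≤ lam1) :
    th 1 = th 0 + (1 / (n : ℝ) * sqNorm (residX U alpha) + lam1 * l1Norm alpha)⁻¹ *
      (1 / (n : ℝ) * (residX U alpha ⬝ᵥ (Y - th 0 • colX U - matZ U *ᵥ ga 0))) := by
  have hn' : (n : ℝ) ≠ 0 := by positivity
  have hpos : 0 < 1 / (n : ℝ) * sqNorm (residX U alpha) + lam1 * l1Norm alpha :=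
    add_pos_of_pos_of_nonneg hG (mul_nonneg hlam1 (l1Norm_nonneg _))
  have hX : residX U alpha ⬝ᵥ colX U =
      n * (1 / (n : ℝ) * sqNorm (residX U alpha) + lam1 * l1Norm alpha) := by
    rw [← nodewise_score_self h.nodewise, residX_dotProduct_colX]
    field_simp
  have hY : Y - matZ U *ᵥ ga 0 = (Y - th 0 • colX U - matZ U *ᵥ ga 0) + th 0 • colX U := by
    abel
  rw [h.theta_step 0, hY, dotProduct_add, dotProduct_smul, smul_eq_mul, hX]
  generalize 1 / (n : ℝ) * sqNorm (residX U alpha) + lam1 * l1Norm alpha = B at hpos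
  field_simp
  ring

/-- The two normalizations differ by `λ₁ ‖α‖₁`, and the score that they multiply is at most
`λ (1 + ‖α‖₁)`. -/
lemma IsRun.abs_theta_one_sub_le (h : IsRun U Y lam1 lam lamt alpha th ga) (hn : 0 < n)
    {gammaStar : Fin p → ℝ} {mu C tau nu : ℝ}
    (hD : DesignConditions U alpha gammaStar mu C tau nu) (hlam1 : 0 ≤ lam1) (hlam : 0 ≤ lam) :
    |th 1 - deSparsified U Y lam1 alpha (th 0) (ga 0)| ≤
      C ^ 2 * (lam1 * l1Norm alpha) * (lam * (1 + l1Norm alpha)) := by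
  rw [h.theta_one_eq hn hD.gram_pos hlam1, deSparsified_eq, tauHatSq]
  have hR := lasso_score_residX_le h.init hlam alpha
  have hL : 0 ≤ lam1 * l1Norm alpha := mul_nonneg hlam1 (l1Norm_nonneg _)
  have hG := hD.gram_pos
  have hC := hD.gram_inv_le
  set R := 1 / (n : ℝ) * (residX U alpha ⬝ᵥ (Y - th 0 • colX U - matZ U *ᵥ ga 0))
  set G := 1 / (n : ℝ) * sqNorm (residX U alpha)
  rw [mul_assoc 2]
  set L := lam1 * l1Norm alpha
  have h1 : th 0 + (G + L)⁻¹ * R - (th 0 + (G + 2 * L)⁻¹ * R) =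
      (G + L)⁻¹ * (G + 2 * L)⁻¹ * L * R := by
    field_simp
    ring
  have h2 : (G + L)⁻¹ ≤ C := (inv_anti₀ hG (by linarith)).trans hC
  have h3 : (G + 2 * L)⁻¹ ≤ C := (inv_anti₀ hG (by linarith)).trans hC
  have h4 : 0 ≤ (G + L)⁻¹ := by positivity
  have h5 : 0 ≤ (G + 2 * L)⁻¹ := by positivity
  rw [h1, abs_mul, abs_of_nonneg (by positivity), sq]
  have hC0 : 0 ≤ C := h4.trans h2
  gcongr

/-- Linearization of the de-sparsified Lasso around the true coefficient. -/
lemma tauHatSq_mul_deSparsified_sub {w : Fin n → ℝ} {thetaStar th0 : ℝ}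
    {gammaStar ga0 : Fin p → ℝ} (h : IsMinOn (nodewiseObj U lam1) Set.univ alpha)
    (hG : 0 < 1 / (n : ℝ) * sqNorm (residX U alpha)) (hlam1 : 0 ≤ lam1) :
    tauHatSq U lam1 alpha *
        (deSparsified U (response U thetaStar gammaStar w) lam1 alpha th0 ga0 - thetaStar) =
      1 / (n : ℝ) * (residX U alpha ⬝ᵥ w) + lam1 * l1Norm alpha * (th0 - thetaStar) -
        1 / (n : ℝ) * (residX U alpha ⬝ᵥ (matZ U *ᵥ (ga0 - gammaStar))) := by
  have hτ : 0 < tauHatSq U lam1 alpha := by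
    have := mul_nonneg hlam1 (l1Norm_nonneg alpha)
    unfold tauHatSq
    linarith
  rw [deSparsified_eq, response_sub_eq, residX_score_eq h]
  field_simp
  unfold tauHatSq
  field_simp
  ring

end Comparison

/-! ### Gaussian noise -/

section Gaussian

instance (n : ℕ) (sigma : ℝ) : IsProbabilityMeasure (noiseLaw n sigma) := by
  unfold noiseLaw; infer_instance

lemma hasLaw_dotProduct_noiseLaw {n : ℕ} (sigma : ℝ) (v : Fin n → ℝ) :
    HasLaw (fun w : Fin n → ℝ => v ⬝ᵥ w)
      (gaussianReal 0 (sigma ^ 2 * sqNorm v).toNNReal) (noiseLaw n sigma) := by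
  have hm : Measurable fun w : Fin n → ℝ => v ⬝ᵥ w := by
    unfold dotProduct; fun_prop
  refine ⟨hm.aemeasurable, ?_⟩
  have hind : iIndepFun (fun (i : Fin n) (w : Fin n → ℝ) => v i * w i) (noiseLaw n sigma) :=
    iIndepFun_pi (X := fun i x => v i * x) fun i => by fun_prop
  have hlaw : ∀ i, (noiseLaw n sigma).map (fun w : Fin n → ℝ => v i * w i) =
      gaussianReal 0 (sigma ^ 2 * v i ^ 2).toNNReal := by
    intro i
    have h1 : HasLaw (fun w : Fin n → ℝ => w i) (gaussianReal 0 (sigma ^ 2).toNNReal)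
        (noiseLaw n sigma) :=
      (measurePreserving_eval (fun _ : Fin n => gaussianReal 0 (sigma ^ 2).toNNReal) i).hasLaw
    have h2 := (gaussianReal_const_mul h1 (v i)).map_eq
    rw [h2, mul_zero]
    congr 1
    ext
    simp only [NNReal.coe_mul, NNReal.coe_mk]
    rw [Real.coe_toNNReal _ (by positivity), Real.coe_toNNReal _ (by positivity)]
    ring
  have : (fun w : Fin n → ℝ => v ⬝ᵥ w) = fun w => ∑ i, v i * w i := rfl
  rw [this]
  refine Measure.ext_of_charFun ?_
  rw [iIndepFun.charFun_map_fun_sum_eq_prod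
    (fun i => ((measurable_pi_apply i).const_mul (v i)).aemeasurable) hind]
  ext t
  simp only [Finset.prod_apply, hlaw, charFun_gaussianReal, ← Complex.exp_sum]
  congr 1
  have h3 : ∀ i, (((sigma ^ 2 * v i ^ 2).toNNReal : ℝ) : ℂ) = sigma ^ 2 * v i ^ 2 := fun i => by
    rw [Real.coe_toNNReal _ (by positivity)]; push_cast; rfl
  have h4 : (((sigma ^ 2 * sqNorm v).toNNReal : ℝ) : ℂ) = sigma ^ 2 * ∑ i, (v i : ℂ) ^ 2 := by
    rw [Real.coe_toNNReal _ (mul_nonneg (sq_nonneg _) (sqNorm_nonneg v)), sqNorm]; push_cast; rfl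
  simp only [h3, h4, Finset.mul_sum, Finset.sum_mul, Finset.sum_div, Complex.ofReal_zero, mul_zero,
    zero_mul, zero_sub, Finset.sum_neg_distrib]

lemma gaussianReal_tail_le {v : NNReal} {V ε : ℝ} (hV : 0 ≤ V) (hv : (v : ℝ) ≤ V) (hε : 0 ≤ ε) :
    gaussianReal 0 v {x | ε ≤ |x|} ≤ ENNReal.ofReal (2 * Real.exp (-ε ^ 2 / (2 * V))) := by
  have hsub : HasSubgaussianMGF id V.toNNReal (gaussianReal 0 v) := by
    refine ⟨fun t => integrable_exp_mul_gaussianReal t, fun t => ?_⟩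
    rw [mgf_id_gaussianReal, Real.coe_toNNReal _ hV]
    refine Real.exp_le_exp.2 ?_
    have := mul_le_mul_of_nonneg_right hv (sq_nonneg t)
    linarith
  have h1 := hsub.measure_ge_le hε
  have h2 := hsub.neg.measure_ge_le hε
  rw [Real.coe_toNNReal _ hV] at h1 h2
  have h3 : {x : ℝ | ε ≤ |x|} ⊆ {x | ε ≤ id x} ∪ {x | ε ≤ (-id) x} := by
    intro x hx
    rw [Set.mem_ofPred_eq] at hx
    rcases le_abs.1 hx with h | h
    · exact Or.inl h
    · exact Or.inr h
  refine (measure_mono h3).trans ((measure_union_le _ _).trans ?_)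
  rw [two_mul, ENNReal.ofReal_add (by positivity) (by positivity)]
  refine add_le_add ?_ ?_
  · rw [← ofReal_measureReal]; exact ENNReal.ofReal_le_ofReal h1
  · rw [← ofReal_measureReal]; exact ENNReal.ofReal_le_ofReal h2

lemma gaussianReal_small_ball_le {v : NNReal} {V ε : ℝ} (hV : 0 < V) (hv : V ≤ v) :
    gaussianReal 0 v {x | |x| ≤ ε} ≤ ENNReal.ofReal (ε / √V) := by
  have hv0 : v ≠ 0 := by
    rintro rfl
    simp at hv
    linarith
  have hs : {x : ℝ | |x| ≤ ε} = Set.Icc (-ε) ε := by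
    ext x; simp [abs_le]
  rw [hs, gaussianReal_apply 0 hv0]
  have hpdf : ∀ x, gaussianPDF 0 v x ≤ ENNReal.ofReal (1 / (2 * √V)) := by
    intro x
    refine ENNReal.ofReal_le_ofReal ?_
    unfold gaussianPDFReal
    have h1 : Real.exp (-(x - 0) ^ 2 / (2 * v)) ≤ 1 := by
      rw [Real.exp_le_one_iff]
      exact div_nonpos_of_nonpos_of_nonneg (by nlinarith [sq_nonneg (x - 0)]) (by positivity)
    have h2 : 2 * √V ≤ √(2 * Real.pi * v) := by
      have h3 : 2 * √V = √(4 * V) := by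
        rw [Real.sqrt_mul (by norm_num)]
        congr 1
        rw [show (4 : ℝ) = 2 ^ 2 by norm_num, Real.sqrt_sq (by norm_num)]
      rw [h3]
      refine Real.sqrt_le_sqrt ?_
      have := Real.two_le_pi
      nlinarith
    have h4 : 0 < 2 * √V := by positivity
    rw [one_div]
    calc _ ≤ (√(2 * Real.pi * v))⁻¹ * 1 := mul_le_mul_of_nonneg_left h1 (by positivity)
      _ ≤ _ := by rw [mul_one]; exact inv_anti₀ h4 h2
  calc ∫⁻ x in Set.Icc (-ε) ε, gaussianPDF 0 v x
      ≤ ∫⁻ _ in Set.Icc (-ε) ε, ENNReal.ofReal (1 / (2 * √V)) := lintegral_mono hpdf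
    _ = ENNReal.ofReal (ε / √V) := by
      rw [setLIntegral_const, Real.volume_Icc, ← ENNReal.ofReal_mul (by positivity)]
      congr 1
      field_simp
      ring

variable {Ω : Type*} [MeasurableSpace Ω] {P : Measure Ω} [IsProbabilityMeasure P] {n p : ℕ}
  {U : Ω → Design n p} {w : Ω → Fin n → ℝ} {sigma : ℝ}

/-- Conditioning on the design: a bound on the noise probability for every fixed design bounds the
joint probability. -/
lemma measure_le_of_forall_design (hU : Measurable U) (hw : HasLaw w (noiseLaw n sigma) P)
    (hind : IndepFun U w P) {s : Set (Design n p × (Fin n → ℝ))} (hs : MeasurableSet s) {c : ℝ≥0∞}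
    (h : ∀ u, noiseLaw n sigma {x | (u, x) ∈ s} ≤ c) : P {ω | (U ω, w ω) ∈ s} ≤ c := by
  have : IsProbabilityMeasure (P.map U) := Measure.isProbabilityMeasure_map hU.aemeasurable
  have h1 := (indepFun_iff_map_prod_eq_prod_map_map hU.aemeasurable hw.aemeasurable).1 hind
  have h2 : P {ω | (U ω, w ω) ∈ s} = P.map (fun ω => (U ω, w ω)) s := by
    rw [Measure.map_apply_of_aemeasurable (hU.aemeasurable.prodMk hw.aemeasurable) hs]
    rfl
  rw [h2, h1, hw.map_eq, Measure.prod_apply hs]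
  calc _ ≤ ∫⁻ _, c ∂(P.map U) := lintegral_mono fun u => h u
    _ = c := by simp

lemma measurable_sqNorm {ι : Type*} [Fintype ι] : Measurable (sqNorm : (ι → ℝ) → ℝ) := by
  unfold sqNorm; fun_prop

lemma measurable_dotProduct {ι : Type*} [Fintype ι] :
    Measurable fun x : (ι → ℝ) × (ι → ℝ) => x.1 ⬝ᵥ x.2 := by
  unfold dotProduct; fun_prop

lemma measure_noise_tail_le (hU : Measurable U) (hw : HasLaw w (noiseLaw n sigma) P)
    (hind : IndepFun U w P) {f : Design n p → Fin n → ℝ} (hf : Measurable f) {V ε : ℝ}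
    (hV : 0 ≤ V) (hε : 0 ≤ ε) :
    P {ω | sqNorm (f (U ω)) ≤ V ∧ ε ≤ |f (U ω) ⬝ᵥ w ω|} ≤
      ENNReal.ofReal (2 * Real.exp (-ε ^ 2 / (2 * (sigma ^ 2 * V)))) := by
  have hd : Measurable fun x : Design n p × (Fin n → ℝ) => |f x.1 ⬝ᵥ x.2| :=
    (measurable_dotProduct.comp ((hf.comp measurable_fst).prodMk measurable_snd)).abs
  refine measure_le_of_forall_design hU hw hind
    (s := {x | sqNorm (f x.1) ≤ V ∧ ε ≤ |f x.1 ⬝ᵥ x.2|})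
    ((measurableSet_le (measurable_sqNorm.comp (hf.comp measurable_fst)) measurable_const).inter
      (measurableSet_le measurable_const hd)) fun u => ?_
  by_cases hu : sqNorm (f u) ≤ V
  · have h1 := (hasLaw_dotProduct_noiseLaw sigma (f u)).measure_eq (p := fun x => ε ≤ |x|)
      (measurableSet_le measurable_const measurable_id.abs)
    simp only [Set.mem_ofPred_eq, hu, true_and]
    rw [h1]
    refine gaussianReal_tail_le (by positivity) ?_ hε
    rw [Real.coe_toNNReal _ (mul_nonneg (sq_nonneg _) (sqNorm_nonneg _))]
    gcongr
  · simp [hu]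

/-- Anti-concentration of the noise along a vector that depends on the design. -/
lemma measure_noise_small_ball_le (hU : Measurable U) (hw : HasLaw w (noiseLaw n sigma) P)
    (hind : IndepFun U w P) (hsigma : 0 < sigma) {f : Design n p → Fin n → ℝ} (hf : Measurable f)
    {V ε : ℝ} (hV : 0 < V) :
    P {ω | V ≤ sqNorm (f (U ω)) ∧ |f (U ω) ⬝ᵥ w ω| ≤ ε} ≤
      ENNReal.ofReal (ε / √(sigma ^ 2 * V)) := by
  have hd : Measurable fun x : Design n p × (Fin n → ℝ) => |f x.1 ⬝ᵥ x.2| :=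
    (measurable_dotProduct.comp ((hf.comp measurable_fst).prodMk measurable_snd)).abs
  refine measure_le_of_forall_design hU hw hind
    (s := {x | V ≤ sqNorm (f x.1) ∧ |f x.1 ⬝ᵥ x.2| ≤ ε})
    ((measurableSet_le measurable_const (measurable_sqNorm.comp (hf.comp measurable_fst))).inter
      (measurableSet_le hd measurable_const)) fun u => ?_
  by_cases hu : V ≤ sqNorm (f u)
  · have h1 := (hasLaw_dotProduct_noiseLaw sigma (f u)).measure_eq (p := fun x => |x| ≤ ε)
      (measurableSet_le measurable_id.abs measurable_const)
    simp only [Set.mem_ofPred_eq, hu, true_and]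
    rw [h1]
    refine gaussianReal_small_ball_le (by positivity) ?_
    rw [Real.coe_toNNReal _ (mul_nonneg (sq_nonneg _) (sqNorm_nonneg _))]
    gcongr
  · simp [hu]

end Gaussian

/-! ### Products of sub-Gaussian variables -/

section Bernstein

variable {Ω : Type*} [MeasurableSpace Ω] {P : Measure Ω}

/-- The square of a sub-Gaussian variable has an exponential moment. The Gaussian integral
`∫ exp (h f - c h²) dh` is a multiple of `exp (f² / (4 c))`, and it can be integrated first over
the probability space. -/
lemma lintegral_exp_sq_le_two [SFinite P] {f : Ω → ℝ} {c : NNReal} (hc : 0 < c) (hf : Measurable f)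
    (h : HasSubgaussianMGF f c P) :
    ∫⁻ ω, ENNReal.ofReal (Real.exp (f ω ^ 2 / (4 * c))) ∂P ≤ 2 := by
  have hc' : (0 : ℝ) < c := hc
  have h1 : ∀ ω, ENNReal.ofReal √(Real.pi / c) * ENNReal.ofReal (Real.exp (f ω ^ 2 / (4 * c))) =
      ∫⁻ x : ℝ, ENNReal.ofReal (Real.exp (x * f ω - c * x ^ 2)) := by
    intro ω
    rw [← ENNReal.ofReal_mul (by positivity), ← integral_gaussian (c : ℝ)]
    have h2 : Integrable fun x : ℝ => Real.exp (-c * x ^ 2) := integrable_exp_neg_mul_sq hc'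
    rw [← integral_sub_right_eq_self (fun x : ℝ => Real.exp (-c * x ^ 2)) (f ω / (2 * c)),
      ← integral_mul_const, ofReal_integral_eq_lintegral_ofReal]
    · refine lintegral_congr fun x => ?_
      rw [← Real.exp_add]
      congr 2
      field_simp
      ring
    · exact (h2.comp_sub_right (f ω / (2 * c))).mul_const _
    · exact ae_of_all _ fun x => by positivity
  have h2 : ENNReal.ofReal √(Real.pi / c) *
      ∫⁻ ω, ENNReal.ofReal (Real.exp (f ω ^ 2 / (4 * c))) ∂P ≤
        ENNReal.ofReal √(Real.pi / c) * 2 := by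
    rw [← lintegral_const_mul _ (by fun_prop)]
    simp only [h1]
    rw [lintegral_lintegral_swap (by fun_prop)]
    calc ∫⁻ x : ℝ, ∫⁻ ω, ENNReal.ofReal (Real.exp (x * f ω - c * x ^ 2)) ∂P
        ≤ ∫⁻ x : ℝ, ENNReal.ofReal (Real.exp (-(c / 2) * x ^ 2)) := by
          refine lintegral_mono fun x => ?_
          have h3 := h.mgf_le x
          have h4 : ∫⁻ ω, ENNReal.ofReal (Real.exp (x * f ω - c * x ^ 2)) ∂P =
              ENNReal.ofReal (mgf f P x * Real.exp (-(c * x ^ 2))) := by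
            rw [mgf, ← integral_mul_const, ofReal_integral_eq_lintegral_ofReal]
            · simp only [← Real.exp_add, sub_eq_add_neg]
            · exact (h.integrable_exp_mul x).mul_const _
            · exact ae_of_all _ fun ω => by positivity
          rw [h4]
          refine ENNReal.ofReal_le_ofReal ?_
          calc mgf f P x * Real.exp (-(c * x ^ 2))
              ≤ Real.exp (c * x ^ 2 / 2) * Real.exp (-(c * x ^ 2)) :=
                mul_le_mul_of_nonneg_right h3 (by positivity)
            _ = Real.exp (-(c / 2) * x ^ 2) := by rw [← Real.exp_add]; congr 1; ring
      _ = ENNReal.ofReal √(Real.pi / (c / 2)) := by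
          rw [← integral_gaussian, ofReal_integral_eq_lintegral_ofReal]
          · exact integrable_exp_neg_mul_sq (by positivity)
          · exact ae_of_all _ fun x => by positivity
      _ ≤ ENNReal.ofReal √(Real.pi / c) * 2 := by
          rw [show (2 : ℝ≥0∞) = ENNReal.ofReal 2 by simp, ← ENNReal.ofReal_mul (by positivity)]
          refine ENNReal.ofReal_le_ofReal ?_
          have : √(Real.pi / c) * 2 = √(Real.pi / c * 4) := by
            rw [Real.sqrt_mul (by positivity), show (4 : ℝ) = 2 ^ 2 by norm_num,
              Real.sqrt_sq (by norm_num)]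
          rw [this]
          refine Real.sqrt_le_sqrt ?_
          have h5 : 0 ≤ Real.pi / c := by positivity
          have h6 : Real.pi / (c / 2) = Real.pi / c * 2 := by field_simp
          rw [h6]; linarith
  have h0 : 0 < √(Real.pi / c) := by positivity
  exact (ENNReal.mul_le_mul_iff_right (by simpa using h0) ENNReal.ofReal_ne_top).1 h2

/-- A product of two sub-Gaussian variables has an exponential moment. No independence is
needed, as `|f g| ≤ (f² + g²) / 2`. -/
lemma lintegral_exp_abs_mul_le_two [SFinite P] {f g : Ω → ℝ} {c : NNReal} (hc : 0 < c)
    (hf : Measurable f) (hg : Measurable g) (hf' : HasSubgaussianMGF f c P)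
    (hg' : HasSubgaussianMGF g c P) :
    ∫⁻ ω, ENNReal.ofReal (Real.exp (|f ω * g ω| / (4 * c))) ∂P ≤ 2 := by
  have hc' : (0 : ℝ) < c := hc
  have h1 : ∀ ω, ENNReal.ofReal (Real.exp (|f ω * g ω| / (4 * c))) ≤
      ENNReal.ofReal (1 / 2) * ENNReal.ofReal (Real.exp (f ω ^ 2 / (4 * c))) +
        ENNReal.ofReal (1 / 2) * ENNReal.ofReal (Real.exp (g ω ^ 2 / (4 * c))) := by
    intro ω
    rw [← ENNReal.ofReal_mul (by norm_num), ← ENNReal.ofReal_mul (by norm_num),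
      ← ENNReal.ofReal_add (by positivity) (by positivity)]
    refine ENNReal.ofReal_le_ofReal ?_
    have h2 : |f ω * g ω| / (4 * c) ≤ f ω ^ 2 / (4 * c) / 2 + g ω ^ 2 / (4 * c) / 2 := by
      have h3 : f ω ^ 2 / (4 * c) / 2 + g ω ^ 2 / (4 * c) / 2 =
          (f ω ^ 2 + g ω ^ 2) / 2 / (4 * c) := by ring
      rw [h3, abs_mul, ← sq_abs (f ω), ← sq_abs (g ω)]
      refine div_le_div_of_nonneg_right ?_ (by positivity)
      linarith [sq_nonneg (|f ω| - |g ω|)]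
    refine (Real.exp_le_exp.2 h2).trans ?_
    have h3 : ∀ x : ℝ, Real.exp x = Real.exp (x / 2) ^ 2 := fun x => by
      rw [← Real.exp_nat_mul]; congr 1; push_cast; ring
    rw [Real.exp_add, h3 (f ω ^ 2 / (4 * c)), h3 (g ω ^ 2 / (4 * c))]
    nlinarith [sq_nonneg (Real.exp (f ω ^ 2 / (4 * c) / 2) - Real.exp (g ω ^ 2 / (4 * c) / 2))]
  refine (lintegral_mono h1).trans ?_
  rw [lintegral_add_left (by fun_prop), lintegral_const_mul _ (by fun_prop),
    lintegral_const_mul _ (by fun_prop)]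
  calc _ ≤ ENNReal.ofReal (1 / 2) * 2 + ENNReal.ofReal (1 / 2) * 2 := by
        gcongr
        · exact lintegral_exp_sq_le_two hc hf hf'
        · exact lintegral_exp_sq_le_two hc hg hg'
    _ = 2 := by
        rw [show (2 : ℝ≥0∞) = ENNReal.ofReal 2 by simp, ← ENNReal.ofReal_mul (by norm_num),
          ← ENNReal.ofReal_add (by norm_num) (by norm_num)]
        norm_num

/-- A second-order bound on the exponential, valid on the whole line. -/
lemma exp_le_one_add_add_sq_mul_exp_abs (x : ℝ) :
    Real.exp x ≤ 1 + x + x ^ 2 * Real.exp |x| := by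
  have h1 : 1 ≤ Real.exp |x| := Real.one_le_exp (abs_nonneg x)
  have h2 : x ^ 2 ≤ x ^ 2 * Real.exp |x| := le_mul_of_one_le_right (sq_nonneg x) h1
  rcases le_or_gt |x| 1 with hx | hx
  · have := (abs_le.1 (Real.abs_exp_sub_one_sub_id_le hx)).2
    linarith
  · rcases lt_abs.1 hx with h | h
    · have h3 : Real.exp |x| ≤ x ^ 2 * Real.exp |x| :=
        le_mul_of_one_le_left (by positivity) (by nlinarith)
      have h4 : Real.exp x ≤ Real.exp |x| := Real.exp_le_exp.2 (le_abs_self x)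
      linarith
    · have h3 : Real.exp x ≤ 1 := Real.exp_le_one_iff.2 (by linarith)
      nlinarith

/-- A centred variable with an exponential moment has a sub-Gaussian moment generating function
near zero. -/
lemma mgf_le_exp_of_integral_exp_abs_le [IsProbabilityMeasure P] {f : Ω → ℝ} {a t : ℝ} (ha : 0 < a)
    (hf : Measurable f) (h0 : ∫ ω, f ω ∂P = 0)
    (h : ∫⁻ ω, ENNReal.ofReal (Real.exp (2 * a * |f ω|)) ∂P ≤ 2) (ht : |t| ≤ a) :
    Integrable (fun ω => Real.exp (t * f ω)) P ∧ mgf f P t ≤ Real.exp (4 * t ^ 2 / a ^ 2) := by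
  have hint : Integrable (fun ω => Real.exp (2 * a * |f ω|)) P := by
    refine ⟨by fun_prop, ?_⟩
    rw [hasFiniteIntegral_iff_ofReal (ae_of_all _ fun ω => by positivity)]
    exact h.trans_lt (by simp)
  have hle : ∫ ω, Real.exp (2 * a * |f ω|) ∂P ≤ 2 := by
    rw [integral_eq_lintegral_of_nonneg_ae (ae_of_all _ fun ω => by positivity) (by fun_prop)]
    exact ENNReal.toReal_le_of_le_ofReal (by norm_num) (by simpa using h)
  have habs : ∀ ω, |t * f ω| ≤ a * |f ω| := fun ω => by
    rw [abs_mul]; exact mul_le_mul_of_nonneg_right ht (abs_nonneg _)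
  have hf1 : Integrable f P := by
    refine (hint.const_mul (1 / (2 * a))).mono' (by fun_prop) (ae_of_all _ fun ω => ?_)
    have := Real.add_one_le_exp (2 * a * |f ω|)
    rw [Real.norm_eq_abs, one_div, inv_mul_eq_div, le_div_iff₀ (by positivity)]
    linarith
  have hexp : Integrable (fun ω => Real.exp (t * f ω)) P := by
    refine hint.mono' (by fun_prop) (ae_of_all _ fun ω => ?_)
    rw [Real.norm_eq_abs, Real.abs_exp]
    refine Real.exp_le_exp.2 ?_
    have h1 := le_abs_self (t * f ω)
    have h2 := habs ω
    have h3 : 0 ≤ a * |f ω| := by positivity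
    linarith
  refine ⟨hexp, ?_⟩
  have hpt : ∀ ω, Real.exp (t * f ω) ≤
      1 + t * f ω + 2 * t ^ 2 / a ^ 2 * Real.exp (2 * a * |f ω|) := by
    intro ω
    refine (exp_le_one_add_add_sq_mul_exp_abs (t * f ω)).trans (add_le_add le_rfl ?_)
    have h1 : Real.exp |t * f ω| ≤ Real.exp (a * |f ω|) := Real.exp_le_exp.2 (habs ω)
    have h2 : (a * |f ω|) ^ 2 ≤ 2 * Real.exp (a * |f ω|) := by
      have h3 : 0 ≤ a * |f ω| := by positivity
      have := Real.quadratic_le_exp_of_nonneg h3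
      linarith
    calc (t * f ω) ^ 2 * Real.exp |t * f ω|
        = t ^ 2 / a ^ 2 * ((a * |f ω|) ^ 2 * Real.exp |t * f ω|) := by
          rw [mul_pow, mul_pow, sq_abs]; field_simp
      _ ≤ t ^ 2 / a ^ 2 * ((2 * Real.exp (a * |f ω|)) * Real.exp (a * |f ω|)) := by gcongr
      _ = 2 * t ^ 2 / a ^ 2 * Real.exp (2 * a * |f ω|) := by
          rw [mul_assoc 2 (Real.exp _), ← Real.exp_add]; ring_nf
  have hlin : Integrable (fun ω => 1 + t * f ω) P := (integrable_const _).add (hf1.const_mul t)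
  have h1 : mgf f P t ≤
      ∫ ω, (1 + t * f ω + 2 * t ^ 2 / a ^ 2 * Real.exp (2 * a * |f ω|)) ∂P :=
    integral_mono hexp (hlin.add (hint.const_mul _)) hpt
  rw [integral_add hlin (hint.const_mul _),
    integral_add (integrable_const _) (hf1.const_mul t), integral_const_mul, integral_const_mul, h0]
    at h1
  simp only [integral_const, probReal_univ, smul_eq_mul, mul_one, mul_zero, add_zero] at h1
  have h2 : 2 * t ^ 2 / a ^ 2 * ∫ ω, Real.exp (2 * a * |f ω|) ∂P ≤ 2 * t ^ 2 / a ^ 2 * 2 :=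
    mul_le_mul_of_nonneg_left hle (by positivity)
  have h3 := Real.add_one_le_exp (4 * t ^ 2 / a ^ 2)
  have h4 : 2 * t ^ 2 / a ^ 2 * 2 = 4 * t ^ 2 / a ^ 2 := by ring
  linarith

/-- A Bernstein inequality for independent copies of a centred variable with an exponential
moment. -/
lemma measure_abs_sum_ge_le [IsProbabilityMeasure P] {E : Type*} [MeasurableSpace E]
    {Q : Measure E} [IsProbabilityMeasure Q] {n : ℕ} {V : Fin n → Ω → E}
    (hV : ∀ i, Measurable (V i)) (hind : iIndepFun V P) (hlaw : ∀ i, HasLaw (V i) Q P)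
    {f : E → ℝ} (hf : Measurable f) {a t : ℝ} (ha : 0 < a) (h0 : ∫ x, f x ∂Q = 0)
    (h : ∫⁻ x, ENNReal.ofReal (Real.exp (2 * a * |f x|)) ∂Q ≤ 2) (ht0 : 0 ≤ t) (ht : t ≤ a)
    (x : ℝ) :
    P {ω | x ≤ |∑ i, f (V i ω)|} ≤
      ENNReal.ofReal (2 * Real.exp (4 * n * t ^ 2 / a ^ 2 - t * x)) := by
  have key : ∀ g : E → ℝ, Measurable g → ∫ x, g x ∂Q = 0 →
      ∫⁻ x, ENNReal.ofReal (Real.exp (2 * a * |g x|)) ∂Q ≤ 2 →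
      P {ω | x ≤ ∑ i, g (V i ω)} ≤ ENNReal.ofReal (Real.exp (4 * n * t ^ 2 / a ^ 2 - t * x)) := by
    intro g hg hg0 hg2
    obtain ⟨h1, h2⟩ := mgf_le_exp_of_integral_exp_abs_le (t := t) ha hg hg0 hg2
      (by rwa [abs_of_nonneg ht0])
    have hind' : iIndepFun (fun i ω => g (V i ω)) P := hind.comp (fun _ => g) fun _ => hg
    have hm : ∀ i, Measurable fun ω => g (V i ω) := fun i => hg.comp (hV i)
    have hmgf : ∀ i, mgf (fun ω => g (V i ω)) P t = mgf g Q t := fun i =>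
      (hlaw i).integral_comp (f := fun x => Real.exp (t * g x)) (by fun_prop)
    have hint : ∀ i, Integrable (fun ω => Real.exp (t * g (V i ω))) P := fun i => by
      have h3 : Integrable (fun x => Real.exp (t * g x)) (P.map (V i)) := by
        rwa [(hlaw i).map_eq]
      exact h3.comp_measurable (hV i)
    have h4 := measure_ge_le_exp_mul_mgf (μ := P) (X := ∑ i, fun ω => g (V i ω)) x ht0
      (hind'.integrable_exp_mul_sum hm fun i _ => hint i)
    rw [hind'.mgf_sum hm] at h4
    simp only [Finset.sum_apply, hmgf, Finset.prod_const, Finset.card_univ, Fintype.card_fin] at h4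
    rw [← ofReal_measureReal]
    refine ENNReal.ofReal_le_ofReal (h4.trans ?_)
    calc Real.exp (-t * x) * mgf g Q t ^ n
        ≤ Real.exp (-t * x) * Real.exp (4 * t ^ 2 / a ^ 2) ^ n := by
          gcongr
          exact mgf_nonneg
      _ = Real.exp (4 * n * t ^ 2 / a ^ 2 - t * x) := by
          rw [← Real.exp_nat_mul, ← Real.exp_add]; ring_nf
  have h1 := key f hf h0 h
  have h2 := key (fun x => -f x) hf.neg (by rw [integral_neg, h0, neg_zero]) (by simpa using h)
  have h3 : {ω | x ≤ |∑ i, f (V i ω)|} ⊆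
      {ω | x ≤ ∑ i, f (V i ω)} ∪ {ω | x ≤ ∑ i, -f (V i ω)} := by
    intro ω hω
    rw [Set.mem_ofPred_eq] at hω
    rcases le_abs.1 hω with h | h
    · exact Or.inl h
    · exact Or.inr (by rw [Set.mem_ofPred_eq, Finset.sum_neg_distrib]; exact h)
  refine (measure_mono h3).trans ((measure_union_le _ _).trans ?_)
  rw [two_mul, ENNReal.ofReal_add (by positivity) (by positivity)]
  exact add_le_add h1 h2

end Bernstein

/-! ### The score of the node-wise regression at the population coefficient -/

section Nodewise

/-- A variance proxy common to the covariates and to the population residual `X - Z α*`, when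
`‖α*‖₁ ≤ A`. -/
noncomputable def varProxy (C0 A : ℝ) : ℝ := max C0 1 * (1 + A ^ 2)

lemma varProxy_pos (C0 A : ℝ) : 0 < varProxy C0 A := by
  have : 0 < max C0 1 := lt_max_of_lt_right one_pos
  unfold varProxy; positivity

variable {p : ℕ} {Q : Measure (ℝ × (Fin p → ℝ))} {C0 A : ℝ}

lemma SubGaussianRow.hasSubgaussianMGF (hQ : SubGaussianRow Q C0) {h0 : ℝ} {h : Fin p → ℝ}
    (hh : h0 ^ 2 + sqNorm h ≤ 1 + A ^ 2) :
    HasSubgaussianMGF (fun u : ℝ × (Fin p → ℝ) => u.1 * h0 + u.2 ⬝ᵥ h)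
      (varProxy C0 A).toNNReal Q := by
  have h1 : ∀ (t : ℝ) (u : ℝ × (Fin p → ℝ)),
      t * (u.1 * h0 + u.2 ⬝ᵥ h) = u.1 * (t * h0) + u.2 ⬝ᵥ (t • h) := fun t u => by
    rw [dotProduct_smul, smul_eq_mul]; ring
  refine ⟨fun t => ?_, fun t => ?_⟩
  · simp only [h1]; exact hQ.integrable_exp _ _
  · simp only [mgf, h1]
    refine (hQ.mgf_le _ _).trans (Real.exp_le_exp.2 ?_)
    rw [Real.coe_toNNReal _ (varProxy_pos C0 A).le]
    have h2 : sqNorm (t • h) = t ^ 2 * sqNorm h := by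
      simp [sqNorm, mul_pow, Finset.mul_sum]
    have h3 : C0 * (h0 ^ 2 + sqNorm h) ≤ varProxy C0 A :=
      (mul_le_mul_of_nonneg_right (le_max_left C0 1)
        (add_nonneg (sq_nonneg _) (sqNorm_nonneg _))).trans
        (mul_le_mul_of_nonneg_left hh (zero_le_one.trans (le_max_right C0 1)))
    rw [h2]
    have h4 := mul_le_mul_of_nonneg_right h3 (sq_nonneg t)
    linarith

lemma SubGaussianRow.hasSubgaussianMGF_coord (hQ : SubGaussianRow Q C0) (A : ℝ) (j : Fin p) :
    HasSubgaussianMGF (fun u : ℝ × (Fin p → ℝ) => u.2 j) (varProxy C0 A).toNNReal Q := by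
  have := hQ.hasSubgaussianMGF (A := A) (h0 := 0) (h := Pi.single j 1) (by
    have : sqNorm (Pi.single j (1 : ℝ) : Fin p → ℝ) ≤ 1 :=
      (sqNorm_le_l1Norm_sq _).trans (by rw [l1Norm_single]; norm_num)
    nlinarith [sq_nonneg A])
  simpa using this

lemma SubGaussianRow.hasSubgaussianMGF_resid (hQ : SubGaussianRow Q C0) {a : Fin p → ℝ}
    (ha : l1Norm a ≤ A) :
    HasSubgaussianMGF (fun u : ℝ × (Fin p → ℝ) => u.1 - u.2 ⬝ᵥ a) (varProxy C0 A).toNNReal Q := by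
  have := hQ.hasSubgaussianMGF (A := A) (h0 := 1) (h := -a) (by
    have h1 : sqNorm (-a) ≤ A ^ 2 := by
      have h2 : sqNorm (-a) = sqNorm a := by simp [sqNorm]
      rw [h2]
      exact (sqNorm_le_l1Norm_sq a).trans (pow_le_pow_left₀ (l1Norm_nonneg a) ha 2)
    linarith)
  simpa [sub_eq_add_neg] using this

/-- The normal equations of the population regression of `X` on `Z`. -/
lemma SubGaussianRow.integral_coord_mul_resid (hQ : SubGaussianRow Q C0)
    (hdet : IsUnit (sigmaZZ Q).det) (j : Fin p) :
    ∫ u, u.2 j * (u.1 - u.2 ⬝ᵥ alphaStar Q) ∂Q = 0 := by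
  have hL2 : ∀ k : Fin p, MemLp (fun u : ℝ × (Fin p → ℝ) => u.2 k) 2 Q := fun k =>
    (hQ.hasSubgaussianMGF_coord 0 k).memLp 2
  have hX2 : MemLp (fun u : ℝ × (Fin p → ℝ) => u.1) 2 Q := by
    have h := (hQ.hasSubgaussianMGF_resid (a := 0) (A := 0) (by simp [l1Norm])).memLp 2
    simpa using h
  have hZX : Integrable (fun u : ℝ × (Fin p → ℝ) => u.2 j * u.1) Q := (hL2 j).integrable_mul hX2
  have hZZ : ∀ k, Integrable (fun u : ℝ × (Fin p → ℝ) => u.2 j * u.2 k * alphaStar Q k) Q :=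
    fun k => ((hL2 j).integrable_mul (hL2 k)).mul_const _
  have h1 : ∀ u : ℝ × (Fin p → ℝ), u.2 j * (u.1 - u.2 ⬝ᵥ alphaStar Q) =
      u.2 j * u.1 - ∑ k, u.2 j * u.2 k * alphaStar Q k := fun u => by
    rw [mul_sub, dotProduct, Finset.mul_sum]
    simp only [mul_assoc]
  simp only [h1]
  rw [integral_sub hZX (integrable_finsetSum _ fun k _ => hZZ k),
    integral_finsetSum _ fun k _ => hZZ k]
  simp only [integral_mul_const]
  have h2 : sigmaZZ Q *ᵥ alphaStar Q = sigmaZX Q := by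
    rw [alphaStar, Matrix.mulVec_mulVec, Matrix.mul_nonsing_inv _ hdet, Matrix.one_mulVec]
  have h3 := congrFun h2 j
  simp only [Matrix.mulVec, dotProduct, sigmaZZ, Matrix.of_apply, sigmaZX] at h3
  rw [h3, sub_self]

/-- With high probability, the score of `X - Z α*` is at most half of
`96 * varProxy C0 A * √(log p / n)`. -/
lemma measure_nodewise_score_le {Ω : Type*} [MeasurableSpace Ω] {P : Measure Ω}
    [IsProbabilityMeasure P] {n : ℕ} (hn : 0 < n) (hp : 0 < p) {U : Ω → Design n p}
    (hU : Measurable U)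
    (hind : iIndepFun (fun (i : Fin n) (ω : Ω) => U ω i) P)
    (hlaw : ∀ i : Fin n, HasLaw (fun ω => U ω i) Q P) (hQ : SubGaussianRow Q C0)
    (hdet : IsUnit (sigmaZZ Q).det) (hA : l1Norm (alphaStar Q) ≤ A)
    (hl : √(Real.log p / n) ≤ 1) :
    P {ω | ¬ ∀ j, |1 / (n : ℝ) * ((matZ (U ω))ᵀ *ᵥ residX (U ω) (alphaStar Q)) j| ≤
      96 * varProxy C0 A * √(Real.log p / n) / 2} ≤ ENNReal.ofReal (2 / p) := by
  have hQp : IsProbabilityMeasure Q := ((hlaw ⟨0, hn⟩).isProbabilityMeasure_iff).1 inferInstance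
  set B := varProxy C0 A with hB
  have hB0 : 0 < B := varProxy_pos C0 A
  set l := √(Real.log p / n) with hldef
  have hl0 : 0 ≤ l := Real.sqrt_nonneg _
  have hn' : (0 : ℝ) < n := by exact_mod_cast hn
  have hp' : (1 : ℝ) ≤ p := by exact_mod_cast hp
  have hnl : n * l ^ 2 = Real.log p := by
    rw [hldef, Real.sq_sqrt (div_nonneg (Real.log_nonneg hp') hn'.le)]
    field_simp
  have hj : ∀ j, P {ω | n * (48 * B * l) ≤
      |∑ i, (U ω i).2 j * ((U ω i).1 - (U ω i).2 ⬝ᵥ alphaStar Q)|} ≤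
      ENNReal.ofReal (2 / p ^ 2) := by
    intro j
    have hm1 : Measurable fun u : ℝ × (Fin p → ℝ) => u.2 j := by fun_prop
    have hm2 : Measurable fun u : ℝ × (Fin p → ℝ) => u.1 - u.2 ⬝ᵥ alphaStar Q := by
      unfold dotProduct; fun_prop
    have h2 := lintegral_exp_abs_mul_le_two (P := Q) (Real.toNNReal_pos.2 hB0) hm1 hm2
      (hQ.hasSubgaussianMGF_coord A j) (hQ.hasSubgaussianMGF_resid hA)
    rw [Real.coe_toNNReal _ hB0.le] at h2
    have h3 := measure_abs_sum_ge_le (V := fun i ω => U ω i) (a := 1 / (8 * B)) (t := l / (8 * B))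
      (fun i => (measurable_pi_apply i).comp hU) hind hlaw (hm1.mul hm2) (by positivity)
      (hQ.integral_coord_mul_resid hdet j) ?_ (by positivity) (by gcongr) (n * (48 * B * l))
    · refine h3.trans (ENNReal.ofReal_le_ofReal (le_of_eq ?_))
      -- the exponent equals `4 log p - 6 log p`
      have h4 : 4 * n * (l / (8 * B)) ^ 2 / (1 / (8 * B)) ^ 2 - l / (8 * B) * (n * (48 * B * l)) =
          -(2 * (n * l ^ 2)) := by
        field_simp; ring
      rw [h4, hnl, Real.exp_neg, two_mul (Real.log _), Real.exp_add, Real.exp_log (by linarith)]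
      field_simp
    · refine le_trans (le_of_eq ?_) h2
      refine lintegral_congr fun u => ?_
      congr 2
      rw [Pi.mul_apply]
      field_simp
      ring
  have hsub : {ω | ¬ ∀ j, |1 / (n : ℝ) * ((matZ (U ω))ᵀ *ᵥ residX (U ω) (alphaStar Q)) j| ≤
      96 * B * l / 2} ⊆ ⋃ j, {ω | n * (48 * B * l) ≤
      |∑ i, (U ω i).2 j * ((U ω i).1 - (U ω i).2 ⬝ᵥ alphaStar Q)|} := by
    intro ω hω
    rw [Set.mem_ofPred_eq] at hω
    push Not at hω
    obtain ⟨j, hj⟩ := hω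
    refine Set.mem_iUnion.2 ⟨j, ?_⟩
    rw [Set.mem_ofPred_eq]
    change _ < |1 / (n : ℝ) * ∑ i, (U ω i).2 j * ((U ω i).1 - (U ω i).2 ⬝ᵥ alphaStar Q)| at hj
    rw [abs_mul, abs_of_pos (by positivity), one_div, inv_mul_eq_div, lt_div_iff₀ hn'] at hj
    linarith
  refine (measure_mono hsub).trans ((measure_iUnion_fintype_le _ _).trans ?_)
  refine (Finset.sum_le_sum fun j _ => hj j).trans (le_of_eq ?_)
  rw [Finset.sum_const, Finset.card_univ, Fintype.card_fin, nsmul_eq_mul,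
    ← ENNReal.ofReal_natCast p, ← ENNReal.ofReal_mul (by positivity)]
  congr 1
  have : (p : ℝ) ≠ 0 := by positivity
  field_simp

end Nodewise

/-! ### Deterministic consequences of the favourable event -/

section Deterministic

/-- On the event where the node-wise Lasso is bounded in the `ℓ₁` norm and the noise scores are
small, the two estimators differ by `O(l²)`, and the Gaussian term `n⁻¹ (X - Z α)ᵀ w` dominates
the error of the de-sparsified Lasso up to a bias of order `s l²`, where `l = √(log p / n)`. -/
lemma exists_comparison_bound {mu : ℝ} (hmu : 0 < mu) {C K a : ℝ} (hC : 1 ≤ C) (hK : 0 ≤ K)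
    (ha : 0 ≤ a) :
    ∃ η > 0, ∃ M ≥ 0, ∀ (n p : ℕ) (U : Design n p) (w : Fin n → ℝ) (thetaStar : ℝ)
      (gammaStar alpha : Fin p → ℝ) (lamt : ℕ → ℝ) (th : ℕ → ℝ) (ga : ℕ → Fin p → ℝ)
      (lam lam1 tau nu s l : ℝ), 0 < n →
      DesignConditions U alpha gammaStar mu C tau nu → l1Norm alpha ≤ a →
      0 ≤ l → 0 < lam → lam ≤ K * l → 0 ≤ lam1 → lam1 ≤ K * l →
      1 ≤ s → ((supp gammaStar).card : ℝ) ≤ s → √s * l ≤ η →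
      |1 / (n : ℝ) * (colX U ⬝ᵥ w)| ≤ lam →
      (∀ j, |1 / (n : ℝ) * ((matZ U)ᵀ *ᵥ w) j| ≤ lam / 2) →
      |1 / (n : ℝ) * (residX U alpha ⬝ᵥ w)| ≤ l →
      IsRun U (response U thetaStar gammaStar w) lam1 lam lamt alpha th ga →
      |th 1 - deSparsified U (response U thetaStar gammaStar w) lam1 alpha (th 0) (ga 0)| ≤
        M * l ^ 2 ∧
      |1 / (n : ℝ) * (residX U alpha ⬝ᵥ w)| ≤
        M * |deSparsified U (response U thetaStar gammaStar w) lam1 alpha (th 0) (ga 0) -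
          thetaStar| + M * (s * l ^ 2) := by
  obtain ⟨η, hη, M, hM, key⟩ := exists_lasso_rate hmu hC hK ha
  have hC0 : 0 ≤ C := zero_le_one.trans hC
  refine ⟨η, hη, C ^ 2 * (K * a) * (K * (1 + a)) + (C + 2 * (K * η * a)) + K * M * (a + 1),
    by positivity, ?_⟩
  intro n p U w thetaStar gammaStar alpha lamt th ga lam lam1 tau nu s l hn hD hα hl hlam hlamK
    hlam1 hlam1K hs hcard hsl hwX hwZ hwR hrun
  obtain ⟨hd, hu⟩ := key n p U w thetaStar (th 0) gammaStar (ga 0) alpha lam lam1 tau nu s l hD hα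
    hl hlam hlamK hlam1 hlam1K hs hcard hsl hwX hwZ hwR hrun.nodewise hrun.init
  have hα0 := l1Norm_nonneg alpha
  have hu0 := l1Norm_nonneg (ga 0 - gammaStar)
  have hx1 : 1 ≤ √s := Real.one_le_sqrt.2 hs
  have hL : lam1 * l1Norm alpha ≤ K * l * a := mul_le_mul hlam1K hα hα0 (by positivity)
  have hL0 : 0 ≤ lam1 * l1Norm alpha := mul_nonneg hlam1 hα0
  have hlη : l ≤ η := (le_mul_of_one_le_left hl hx1).trans hsl
  have p1 : 0 ≤ C ^ 2 * (K * a) * (K * (1 + a)) := by positivity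
  have p2 : 0 ≤ C + 2 * (K * η * a) := by positivity
  have p3 : 0 ≤ K * M * (a + 1) := by positivity
  have hl2 : 0 ≤ l ^ 2 := sq_nonneg l
  constructor
  · refine (hrun.abs_theta_one_sub_le hn hD hlam1 hlam.le).trans ?_
    have h1 : lam * (1 + l1Norm alpha) ≤ K * l * (1 + a) :=
      mul_le_mul hlamK (by linarith) (by linarith) (by positivity)
    calc C ^ 2 * (lam1 * l1Norm alpha) * (lam * (1 + l1Norm alpha))
        ≤ C ^ 2 * (K * l * a) * (K * l * (1 + a)) := by gcongr
      _ = C ^ 2 * (K * a) * (K * (1 + a)) * l ^ 2 := by ring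
      _ ≤ _ := mul_le_mul_of_nonneg_right (by linarith) hl2
  · have hlin := tauHatSq_mul_deSparsified_sub (w := w) (thetaStar := thetaStar) (th0 := th 0)
      (gammaStar := gammaStar) (ga0 := ga 0) hrun.nodewise hD.gram_pos hlam1
    set b := deSparsified U (response U thetaStar gammaStar w) lam1 alpha (th 0) (ga 0)
    set T := tauHatSq U lam1 alpha with hT
    have hT0 : 0 ≤ T := by
      have := hD.gram_pos
      rw [hT, tauHatSq]; linarith
    have hT1 : T ≤ C + 2 * (K * η * a) := by
      have h1 := hD.gram_le
      have h2 : K * l * a ≤ K * η * a := by gcongr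
      rw [hT, tauHatSq]; linarith
    have hcross : |1 / (n : ℝ) * (residX U alpha ⬝ᵥ (matZ U *ᵥ (ga 0 - gammaStar)))| ≤
        lam1 * l1Norm (ga 0 - gammaStar) := by
      rw [dotProduct_mulVec_eq]
      exact abs_dotProduct_le (nodewise_score_le hlam1 hrun.nodewise)
    have hcross' : lam1 * l1Norm (ga 0 - gammaStar) ≤ K * M * (s * l ^ 2) := by
      calc _ ≤ K * l * (M * (s * l)) := mul_le_mul hlam1K hu hu0 (by positivity)
        _ = _ := by ring
    have hshift : |lam1 * l1Norm alpha * (th 0 - thetaStar)| ≤ K * M * a * (s * l ^ 2) := by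
      rw [abs_mul, abs_of_nonneg hL0]
      calc _ ≤ K * l * a * (M * (√s * l)) := mul_le_mul hL hd (abs_nonneg _) (by positivity)
        _ = K * M * a * l ^ 2 * √s := by ring
        _ ≤ K * M * a * l ^ 2 * s := by
          refine mul_le_mul_of_nonneg_left ?_ (by positivity)
          exact Real.sqrt_le_iff.2 ⟨by linarith, by nlinarith⟩
        _ = _ := by ring
    have hmain : |T * (b - thetaStar)| ≤ (C + 2 * (K * η * a)) * |b - thetaStar| := by
      rw [abs_mul, abs_of_nonneg hT0]
      exact mul_le_mul_of_nonneg_right hT1 (abs_nonneg _)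
    have hb0 := abs_nonneg (b - thetaStar)
    have hsl2 : 0 ≤ s * l ^ 2 := by positivity
    have hsum : |1 / (n : ℝ) * (residX U alpha ⬝ᵥ w)| ≤
        (C + 2 * (K * η * a)) * |b - thetaStar| + K * M * (a + 1) * (s * l ^ 2) := by
      rw [abs_le] at hmain hshift hcross ⊢
      constructor <;> linarith
    refine hsum.trans (add_le_add ?_ ?_)
    · exact mul_le_mul_of_nonneg_right (by linarith) hb0
    · exact mul_le_mul_of_nonneg_right (by linarith) hsl2

end Deterministic

/-! ### Probability of the noise events -/

section Noise

variable {Ω : Type*} [MeasurableSpace Ω] {P : Measure Ω} [IsProbabilityMeasure P] {n p : ℕ}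
  {U : Ω → Design n p} {w : Ω → Fin n → ℝ} {sigma C lam : ℝ}

/-- Tail bound, in the empirical normalization, for the noise score along a vector that depends on
the design. -/
lemma measure_score_gt_le (hU : Measurable U) (hw : HasLaw w (noiseLaw n sigma) P)
    (hind : IndepFun U w P) {f : Design n p → Fin n → ℝ} (hf : Measurable f)
    (hC : 0 ≤ C) {x : ℝ} (hx : 0 ≤ x) :
    P {ω | 1 / (n : ℝ) * sqNorm (f (U ω)) ≤ C ∧ x < |1 / (n : ℝ) * (f (U ω) ⬝ᵥ w ω)|} ≤
      ENNReal.ofReal (2 * Real.exp (-(n * x ^ 2 / (2 * (sigma ^ 2 * C))))) := by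
  rcases Nat.eq_zero_or_pos n with rfl | hn
  · have : {ω | 1 / ((0 : ℕ) : ℝ) * sqNorm (f (U ω)) ≤ C ∧
        x < |1 / ((0 : ℕ) : ℝ) * (f (U ω) ⬝ᵥ w ω)|} = ∅ := by
      ext ω; simp [hx]
    rw [this]; simp
  have hn' : (0 : ℝ) < n := by exact_mod_cast hn
  have h1 := measure_noise_tail_le (V := n * C) (ε := n * x) hU hw hind hf (by positivity)
    (by positivity)
  have h2 : -(n * x) ^ 2 / (2 * (sigma ^ 2 * (n * C))) =
      -(n * x ^ 2 / (2 * (sigma ^ 2 * C))) := by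
    rw [neg_div, show (n * x) ^ 2 = n * (n * x ^ 2) by ring,
      show 2 * (sigma ^ 2 * (n * C)) = n * (2 * (sigma ^ 2 * C)) by ring,
      mul_div_mul_left _ _ hn'.ne']
  rw [h2] at h1
  refine (measure_mono fun ω hω => ?_).trans h1
  rw [Set.mem_ofPred_eq, abs_mul, abs_of_pos (by positivity), one_div, inv_mul_eq_div,
    inv_mul_eq_div, div_le_iff₀ hn', lt_div_iff₀ hn'] at hω
  rw [Set.mem_ofPred_eq]
  exact ⟨by linarith [hω.1], by linarith [hω.2]⟩

/-- The summand `4 σ C² / √n` in the lower bound on `λ` provides the factor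
`exp (-2 C √(2 C log p))` that makes the union bound over the `p` columns of `Z` vanish. -/
lemma exp_neg_le_of_le_lam (hsigma : 0 < sigma) (hC : 1 ≤ C) (hn : 0 < n) (hp : 0 < p)
    (hlam : 2 * sigma * √(2 * C * Real.log p / n) + 4 * sigma * C ^ 2 / √n ≤ lam) :
    2 * Real.exp (-(n * (lam / 2) ^ 2 / (2 * (sigma ^ 2 * C)))) ≤
      2 / p * Real.exp (-(2 * C * √(2 * C * Real.log p))) := by
  have hn' : (0 : ℝ) < n := by exact_mod_cast hn
  have hp' : (1 : ℝ) ≤ p := by exact_mod_cast hp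
  have hC0 : 0 < C := by linarith
  have hlog : 0 ≤ Real.log p := Real.log_nonneg hp'
  set q := √(2 * C * Real.log p) with hq
  have hq2 : q ^ 2 = 2 * C * Real.log p := Real.sq_sqrt (by positivity)
  have hq0 : 0 ≤ q := Real.sqrt_nonneg _
  have hsn : 0 < √(n : ℝ) := Real.sqrt_pos.2 hn'
  have hsn2 : √(n : ℝ) ^ 2 = n := Real.sq_sqrt hn'.le
  rw [Real.sqrt_div' _ hn'.le, ← hq] at hlam
  have h1 : sigma * (q + 2 * C ^ 2) ≤ √n * (lam / 2) := by
    have : 2 * sigma * (q / √n) + 4 * sigma * C ^ 2 / √n = 2 * (sigma * (q + 2 * C ^ 2)) / √n := by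
      field_simp; ring
    rw [this, div_le_iff₀ hsn] at hlam
    linarith
  have h2 : (sigma * (q + 2 * C ^ 2)) ^ 2 ≤ n * (lam / 2) ^ 2 := by
    rw [← hsn2, ← mul_pow]
    exact pow_le_pow_left₀ (by positivity) h1 2
  have h3 : Real.log p + 2 * C * q ≤ n * (lam / 2) ^ 2 / (2 * (sigma ^ 2 * C)) := by
    rw [le_div_iff₀ (by positivity)]
    refine le_trans ?_ h2
    have h4 : 0 ≤ sigma ^ 2 * C ^ 4 := by positivity
    have h5 : (sigma * (q + 2 * C ^ 2)) ^ 2 =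
        sigma ^ 2 * (2 * C * Real.log p) + 4 * (sigma ^ 2 * C ^ 2 * q) + 4 * (sigma ^ 2 * C ^ 4) := by
      rw [← hq2]; ring
    rw [h5]
    linarith
  calc 2 * Real.exp (-(n * (lam / 2) ^ 2 / (2 * (sigma ^ 2 * C))))
      ≤ 2 * Real.exp (-(Real.log p + 2 * C * q)) := by gcongr
    _ = 2 / p * Real.exp (-(2 * C * q)) := by
      rw [neg_add, Real.exp_add, Real.exp_neg (Real.log p), Real.exp_log (by linarith)]
      ring

lemma measurable_colX : Measurable (colX : Design n p → Fin n → ℝ) := by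
  unfold colX; fun_prop

lemma measurable_matZ_col (j : Fin p) :
    Measurable fun U : Design n p => fun i => matZ U i j := by
  unfold matZ
  simp only [Matrix.of_apply]
  fun_prop

lemma measurable_residX {alpha : Design n p → Fin p → ℝ} (h : Measurable alpha) :
    Measurable fun U : Design n p => residX U (alpha U) := by
  refine measurable_pi_lambda _ fun i => ?_
  simp only [residX, colX, matZ, Pi.sub_apply, Matrix.mulVec, dotProduct, Matrix.of_apply]
  fun_prop

lemma measure_score_matZ_gt_le (hU : Measurable U) (hw : HasLaw w (noiseLaw n sigma) P)
    (hind : IndepFun U w P) (hsigma : 0 < sigma) (hC : 1 ≤ C) (hn : 0 < n) (hp : 0 < p)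
    (hlam0 : 0 ≤ lam)
    (hlam : 2 * sigma * √(2 * C * Real.log p / n) + 4 * sigma * C ^ 2 / √n ≤ lam) :
    P {ω | (∀ j, 1 / (n : ℝ) * sqNorm (fun i => matZ (U ω) i j) ≤ C) ∧
        ¬ ∀ j, |1 / (n : ℝ) * ((matZ (U ω))ᵀ *ᵥ w ω) j| ≤ lam / 2} ≤
      ENNReal.ofReal (2 * Real.exp (-(2 * C * √(2 * C * Real.log p)))) := by
  have hsub : {ω | (∀ j, 1 / (n : ℝ) * sqNorm (fun i => matZ (U ω) i j) ≤ C) ∧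
        ¬ ∀ j, |1 / (n : ℝ) * ((matZ (U ω))ᵀ *ᵥ w ω) j| ≤ lam / 2} ⊆
      ⋃ j, {ω | 1 / (n : ℝ) * sqNorm (fun i => matZ (U ω) i j) ≤ C ∧
        lam / 2 < |1 / (n : ℝ) * ((fun i => matZ (U ω) i j) ⬝ᵥ w ω)|} := by
    intro ω hω
    rw [Set.mem_ofPred_eq] at hω
    obtain ⟨h1, h2⟩ := hω
    push Not at h2
    obtain ⟨j, hj⟩ := h2
    exact Set.mem_iUnion.2 ⟨j, h1 j, hj⟩
  refine (measure_mono hsub).trans ((measure_iUnion_fintype_le _ _).trans ?_)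
  refine (Finset.sum_le_sum fun j _ => (measure_score_gt_le hU hw hind (measurable_matZ_col j)
    (zero_le_one.trans hC) (by linarith)).trans
      (ENNReal.ofReal_le_ofReal (exp_neg_le_of_le_lam hsigma hC hn hp hlam))).trans (le_of_eq ?_)
  have : (p : ℝ) ≠ 0 := by positivity
  rw [Finset.sum_const, Finset.card_univ, Fintype.card_fin, nsmul_eq_mul,
    ← ENNReal.ofReal_natCast p, ← ENNReal.ofReal_mul (by positivity)]
  congr 1
  field_simp

end Noise

/-! ### Events of probability tending to one -/

section HighProbability

variable {Ω : ℕ → Type*} [∀ n, MeasurableSpace (Ω n)] {P : ∀ n, Measure (Ω n)}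

/-- The events `A n` have probability tending to one. Complements are used, with outer measure,
since no measurability is assumed. -/
def HoldsWHP (P : ∀ n, Measure (Ω n)) (A : ∀ n, Ω n → Prop) : Prop :=
  Tendsto (fun n => P n {ω | ¬ A n ω}) atTop (𝓝 0)

lemma tendsto_measure_of_le {A : ∀ n, Ω n → Prop} {f : ℕ → ℝ} (hf : Tendsto f atTop (𝓝 0))
    (h : ∀ᶠ n in atTop, P n {ω | A n ω} ≤ ENNReal.ofReal (f n)) :
    Tendsto (fun n => P n {ω | A n ω}) atTop (𝓝 0) := by
  have hf' : Tendsto (fun n => ENNReal.ofReal (f n)) atTop (𝓝 0) := by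
    simpa using ENNReal.tendsto_ofReal hf
  exact tendsto_of_tendsto_of_tendsto_of_le_of_le' tendsto_const_nhds hf'
    (Eventually.of_forall fun _ => zero_le) h

/-- An event whose intersection with events of probability tending to one is negligible is
negligible. -/
lemma HoldsWHP.tendsto_measure {A B : ∀ n, Ω n → Prop} (hA : HoldsWHP P A)
    (hB : Tendsto (fun n => P n {ω | A n ω ∧ B n ω}) atTop (𝓝 0)) :
    Tendsto (fun n => P n {ω | B n ω}) atTop (𝓝 0) := by
  have h := hA.add hB
  rw [add_zero] at h
  refine tendsto_of_tendsto_of_tendsto_of_le_of_le tendsto_const_nhds h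
    (fun _ => zero_le) fun n => ?_
  refine (measure_mono fun ω hω => ?_).trans (measure_union_le _ _)
  by_cases hAω : A n ω
  · exact Or.inr ⟨hAω, hω⟩
  · exact Or.inl hAω

lemma HoldsWHP.and {A B : ∀ n, Ω n → Prop} (hA : HoldsWHP P A) (hB : HoldsWHP P B) :
    HoldsWHP P fun n ω => A n ω ∧ B n ω := by
  have h := Tendsto.add hA hB
  rw [add_zero] at h
  refine tendsto_of_tendsto_of_tendsto_of_le_of_le tendsto_const_nhds h
    (fun _ => zero_le) fun n => ?_
  refine (measure_mono fun ω hω => ?_).trans (measure_union_le _ _)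
  exact not_and_or.1 hω

lemma tendsto_measure_mono {A B : ∀ n, Ω n → Prop}
    (hB : Tendsto (fun n => P n {ω | B n ω}) atTop (𝓝 0))
    (h : ∀ᶠ n in atTop, ∀ ω, A n ω → B n ω) :
    Tendsto (fun n => P n {ω | A n ω}) atTop (𝓝 0) :=
  tendsto_of_tendsto_of_tendsto_of_le_of_le' tendsto_const_nhds hB
    (Eventually.of_forall fun _ => zero_le) (h.mono fun _ hn => measure_mono fun _ hω => hn _ hω)

lemma HoldsWHP.eventually_exists [∀ n, IsProbabilityMeasure (P n)] {A : ∀ n, Ω n → Prop}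
    (hA : HoldsWHP P A) : ∀ᶠ n in atTop, ∃ ω, A n ω := by
  have h : ∀ᶠ n in atTop, P n {ω | ¬ A n ω} < 1 := hA.eventually (gt_mem_nhds one_pos)
  filter_upwards [h] with n hn
  by_contra! hc
  have : {ω | ¬ A n ω} = Set.univ := Set.eq_univ_of_forall hc
  rw [this, measure_univ] at hn
  exact lt_irrefl _ hn

end HighProbability

end CLasso

theorem proposition1 (C0 A : ℝ) :
    ∃ D0 : ℝ, 0 < D0 ∧
    ∀ (Ω : ℕ → Type*) [∀ n, MeasurableSpace (Ω n)]
      (P : ∀ n, Measure (Ω n)) [∀ n, IsProbabilityMeasure (P n)]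
      -- dimension, sparsity, true parameters, noise level
      (p s : ℕ → ℕ) (thetaStar : ℕ → ℝ) (gammaStar : ∀ n, Fin (p n) → ℝ) (sigma : ℝ)
      -- random design with i.i.d. rows of law `Q n`, and noise
      (Q : ∀ n, Measure (ℝ × (Fin (p n) → ℝ)))
      (U : ∀ n, Ω n → CLasso.Design n (p n)) (w : ∀ n, Ω n → Fin n → ℝ)
      -- constants and sequences in the conditions on the design
      (mu C : ℝ) (tau nu rho : ℕ → ℝ)
      -- regularization parameters, and what the algorithm computes
      (lam1 lam : ℕ → ℝ) (lamt : ∀ n, Ω n → ℕ → ℝ)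
      (alpha : ∀ n, CLasso.Design n (p n) → Fin (p n) → ℝ)
      (th : ∀ n, Ω n → ℕ → ℝ) (ga : ∀ n, Ω n → ℕ → Fin (p n) → ℝ),
      -- the linear model
      0 < sigma →
      (∀ n, Measurable (U n)) →
      (∀ n, iIndepFun (fun (i : Fin n) (ω : Ω n) => U n ω i) (P n)) →
      (∀ n, ∀ i : Fin n, HasLaw (fun ω => U n ω i) (Q n) (P n)) →
      (∀ n, HasLaw (w n) (CLasso.noiseLaw n sigma) (P n)) →
      (∀ n, IndepFun (U n) (w n) (P n)) →
      -- sub-Gaussian rows, and a population coefficient bounded in the `ℓ₁` norm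
      (∀ n, CLasso.SubGaussianRow (Q n) C0) →
      (∀ n, IsUnit (CLasso.sigmaZZ (Q n)).det) →
      (∀ n, CLasso.l1Norm (CLasso.alphaStar (Q n)) ≤ A) →
      -- sparsity and size of the nuisance parameter
      (∀ n, 1 ≤ s n) →
      (∀ n, (CLasso.supp (gammaStar n)).card ≤ s n) →
      (∀ n, CLasso.l1Norm (gammaStar n) ≤ rho n) →
      -- conditions on the design, which hold with probability tending to one
      0 < mu →
      (∀ n, nu n ≤ (2 * C)⁻¹) →
      Tendsto (fun n => P n {ω | ¬ CLasso.DesignConditions (U n ω) (alpha n (U n ω))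
        (gammaStar n) mu C (tau n) (nu n)}) atTop (𝓝 0) →
      -- regularization parameters of order `√(log p / n)`
      (∀ᶠ n in atTop, 2 * sigma * √(2 * C * Real.log (p n) / n) + 4 * sigma * C ^ 2 / √n
        + 8 * C * rho n * tau n ≤ lam n) →
      (lam =O[atTop] fun n => √(Real.log (p n) / n)) →
      (∀ᶠ n in atTop, D0 * √(Real.log (p n) / n) ≤ lam1 n) →
      (lam1 =O[atTop] fun n => √(Real.log (p n) / n)) →
      -- the algorithm, initialized at the Lasso
      (∀ n, Measurable (alpha n)) →
      (∀ n ω, CLasso.IsRun (U n ω) (CLasso.response (U n ω) (thetaStar n) (gammaStar n) (w n ω))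
        (lam1 n) (lam n) (lamt n ω) (alpha n (U n ω)) (th n ω) (ga n ω)) →
      -- the asymptotic regime
      Tendsto p atTop atTop →
      Tendsto (fun n => √((s n : ℝ) / n) * Real.log (p n)) atTop (𝓝 0) →
      -- conclusions, for the de-sparsified Lasso `b`
      ∀ b : ∀ n, Ω n → ℝ,
        (∀ n ω, b n ω = CLasso.deSparsified (U n ω)
          (CLasso.response (U n ω) (thetaStar n) (gammaStar n) (w n ω))
          (lam1 n) (alpha n (U n ω)) (th n ω 0) (ga n ω 0)) →
        CLasso.IsBigOP P (fun n ω => th n ω 1 - b n ω)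
          (fun n => √(s n : ℝ) * Real.log (p n) / n) ∧
        (Tendsto (fun n => (s n : ℝ) * Real.log (p n) / √n) atTop (𝓝 0) →
          CLasso.IsLittleOP P (fun n _ => √(s n : ℝ) * Real.log (p n) / n)
            (fun n ω => b n ω - thetaStar n) ∧
          CLasso.IsLittleOP P (fun n ω => th n ω 1 - b n ω)
            (fun n ω => b n ω - thetaStar n)) := by
  refine ⟨96 * CLasso.varProxy C0 A, mul_pos (by norm_num) (CLasso.varProxy_pos C0 A), ?_⟩
  intro Ω _ P _ p s thetaStar gammaStar sigma Q U w mu C tau nu rho lam1 lam lamt alpha th ga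
    hsigma hU hrows hlaw hw hind hQ hdet hA hs hcard hrho hmu _ hdesign hlam hlamO hlam1 hlam1O
    halpha hrun hp hreg b hb
  have hD : CLasso.HoldsWHP P fun n ω => CLasso.DesignConditions (U n ω) (alpha n (U n ω))
    (gammaStar n) mu C (tau n) (nu n) := hdesign
  have hC : 1 ≤ C := by
    obtain ⟨n, ω, h⟩ := hD.eventually_exists.exists
    exact h.one_le
  have hC0 : 0 < C := by linarith
  have hA0 : 0 ≤ A := (CLasso.l1Norm_nonneg _).trans (hA 0)
  set l : ℕ → ℝ := fun n => √(Real.log (p n) / n) with hldef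
  have hl0 : ∀ n, 0 ≤ l n := fun n => Real.sqrt_nonneg _
  have hs1 : ∀ n, (1 : ℝ) ≤ s n := fun n => by exact_mod_cast hs n
  have hss : ∀ n, 1 ≤ √(s n : ℝ) := fun n => Real.one_le_sqrt.2 (hs1 n)
  have hn0 : ∀ᶠ n : ℕ in atTop, 0 < n := eventually_gt_atTop 0
  have hp0 : ∀ᶠ n in atTop, 0 < p n := hp.eventually (eventually_gt_atTop 0)
  have hlogp : Tendsto (fun n => Real.log (p n)) atTop atTop :=
    Real.tendsto_log_atTop.comp (tendsto_natCast_atTop_atTop.comp hp)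
  have hlog1 : ∀ᶠ n in atTop, 1 ≤ Real.log (p n) := hlogp.eventually (eventually_ge_atTop 1)
  have hl2 : ∀ᶠ n in atTop, l n ^ 2 = Real.log (p n) / n := by
    filter_upwards [hlog1] with n h1
    exact Real.sq_sqrt (by positivity)
  have hsl : Tendsto (fun n => √(s n : ℝ) * l n) atTop (𝓝 0) := by
    refine tendsto_of_tendsto_of_tendsto_of_le_of_le' tendsto_const_nhds hreg
      (Eventually.of_forall fun n => mul_nonneg (Real.sqrt_nonneg _) (hl0 n)) ?_
    filter_upwards [hlog1] with n h1
    have h2 : √(Real.log (p n)) ≤ Real.log (p n) := by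
      refine Real.sqrt_le_iff.2 ⟨by linarith, by nlinarith⟩
    simp only [hldef]
    rw [Real.sqrt_div' _ (Nat.cast_nonneg n), Real.sqrt_div' _ (Nat.cast_nonneg n),
      mul_div_assoc', div_mul_eq_mul_div]
    gcongr
  have hlam0 : ∀ᶠ n in atTop,
      2 * sigma * √(2 * C * Real.log (p n) / n) + 4 * sigma * C ^ 2 / √n ≤ lam n := by
    filter_upwards [hlam, hp0, hD.eventually_exists] with n h1 h2 ⟨ω, h3⟩
    have h4 : 0 ≤ tau n := (abs_nonneg _).trans (h3.cross_le ⟨0, h2⟩)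
    have h5 : 0 ≤ rho n := (CLasso.l1Norm_nonneg _).trans (hrho n)
    have h6 : 0 ≤ 8 * C * rho n * tau n := by positivity
    linarith
  have hlampos : ∀ᶠ n in atTop, 0 < lam n := by
    filter_upwards [hlam0, hn0] with n h1 h2
    have h3 : 0 < √(n : ℝ) := Real.sqrt_pos.2 (by exact_mod_cast h2)
    have h4 : 0 < 4 * sigma * C ^ 2 / √n := by positivity
    have h5 : 0 ≤ 2 * sigma * √(2 * C * Real.log (p n) / n) := by positivity
    linarith
  obtain ⟨K, hK, hlamK, hlam1K⟩ : ∃ K : ℝ, 0 ≤ K ∧ (∀ᶠ n in atTop, lam n ≤ K * l n) ∧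
      ∀ᶠ n in atTop, lam1 n ≤ K * l n := by
    obtain ⟨K, hK, h1⟩ := hlamO.exists_nonneg
    obtain ⟨K', hK', h2⟩ := hlam1O.exists_nonneg
    refine ⟨K + K', by positivity, ?_, ?_⟩
    · filter_upwards [h1.bound] with n h
      rw [Real.norm_of_nonneg (hl0 n)] at h
      have := mul_nonneg hK' (hl0 n)
      linarith [(le_abs_self (lam n)).trans h]
    · filter_upwards [h2.bound] with n h
      rw [Real.norm_of_nonneg (hl0 n)] at h
      have := mul_nonneg hK (hl0 n)
      linarith [(le_abs_self (lam1 n)).trans h]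
  have hlam1pos : ∀ᶠ n in atTop, 0 < lam1 n := by
    filter_upwards [hlam1, hn0, hlog1] with n h1 h2 h3
    have h4 : 0 < √(Real.log (p n) / n) := Real.sqrt_pos.2 (by positivity)
    exact lt_of_lt_of_le (mul_pos (mul_pos (by norm_num) (CLasso.varProxy_pos C0 A)) h4) h1
  have hpinv : Tendsto (fun n => 2 / (p n : ℝ)) atTop (𝓝 0) :=
    tendsto_const_nhds.div_atTop (tendsto_natCast_atTop_atTop.comp hp)
  have hl1 : ∀ᶠ n in atTop, l n ≤ 1 := by
    filter_upwards [hsl.eventually (ge_mem_nhds one_pos)] with n h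
    exact (le_mul_of_one_le_left (hl0 n) (hss n)).trans h
  -- the node-wise Lasso is bounded in the `ℓ₁` norm
  have hE1 : CLasso.HoldsWHP P fun n ω => CLasso.l1Norm (alpha n (U n ω)) ≤ 3 * A := by
    refine CLasso.tendsto_measure_of_le hpinv ?_
    filter_upwards [hn0, hp0, hl1, hlam1, hlam1pos] with n h1 h2 h3 h4 h5
    refine (measure_mono fun ω hω => ?_).trans (CLasso.measure_nodewise_score_le h1 h2 (hU n)
      (hrows n) (hlaw n) (hQ n) (hdet n) (hA n) h3)
    refine fun hc => hω ?_
    refine (CLasso.l1Norm_nodewise_le h5 (hrun n ω).nodewise fun j => (hc j).trans ?_).trans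
      (mul_le_mul_of_nonneg_left (hA n) (by norm_num))
    linarith
  -- the noise scores
  have hexp : Tendsto (fun n => 2 * Real.exp (-(2 * C * √(2 * C * Real.log (p n))))) atTop
      (𝓝 0) := by
    have h1 : Tendsto (fun n => 2 * C * √(2 * C * Real.log (p n))) atTop atTop :=
      (Real.tendsto_sqrt_atTop.comp (hlogp.const_mul_atTop (by positivity))).const_mul_atTop
        (by positivity)
    simpa using (Real.tendsto_exp_neg_atTop_nhds_zero.comp h1).const_mul 2
  have hE2 : CLasso.HoldsWHP P fun n ω =>
      ∀ j, |1 / (n : ℝ) * ((CLasso.matZ (U n ω))ᵀ *ᵥ w n ω) j| ≤ lam n / 2 := by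
    refine hD.tendsto_measure (CLasso.tendsto_measure_of_le hexp ?_)
    filter_upwards [hn0, hp0, hlam0, hlampos] with n h1 h2 h3 h4
    refine le_trans (measure_mono ?_)
      (CLasso.measure_score_matZ_gt_le (hU n) (hw n) (hind n) hsigma hC h1 h2 h4.le h3)
    exact fun ω hω => ⟨hω.1.colZ_le, hω.2⟩
  have hE3 : CLasso.HoldsWHP P fun n ω =>
      |1 / (n : ℝ) * (CLasso.colX (U n ω) ⬝ᵥ w n ω)| ≤ lam n := by
    refine hD.tendsto_measure (CLasso.tendsto_measure_of_le hexp ?_)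
    filter_upwards [hn0, hp0, hlam0, hlampos] with n h1 h2 h3 h4
    refine le_trans (measure_mono fun ω hω => ?_)
      ((CLasso.measure_score_gt_le (hU n) (hw n) (hind n) CLasso.measurable_colX hC0.le
        (half_pos h4).le).trans (ENNReal.ofReal_le_ofReal
          ((CLasso.exp_neg_le_of_le_lam hsigma hC h1 h2 h3).trans ?_)))
    · exact ⟨hω.1.colX_le, (half_lt_self h4).trans (not_le.1 hω.2)⟩
    · gcongr
      exact div_le_self (by norm_num) (by exact_mod_cast h2)
  have hE4 : CLasso.HoldsWHP P fun n ω =>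
      |1 / (n : ℝ) * (CLasso.residX (U n ω) (alpha n (U n ω)) ⬝ᵥ w n ω)| ≤ l n := by
    have h0 : Tendsto (fun n => 2 * Real.exp (-(Real.log (p n) / (2 * (sigma ^ 2 * C))))) atTop
        (𝓝 0) := by
      have h1 : Tendsto (fun n => Real.log (p n) / (2 * (sigma ^ 2 * C))) atTop atTop :=
        hlogp.atTop_div_const (by positivity)
      simpa using (Real.tendsto_exp_neg_atTop_nhds_zero.comp h1).const_mul 2
    refine hD.tendsto_measure (CLasso.tendsto_measure_of_le h0 ?_)
    filter_upwards [hn0, hl2] with n h1 h2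
    have h3 : n * l n ^ 2 = Real.log (p n) := by
      rw [h2]; field_simp
    rw [← h3]
    refine le_trans (measure_mono ?_)
      (CLasso.measure_score_gt_le (hU n) (hw n) (hind n) (CLasso.measurable_residX (halpha n))
        hC0.le (hl0 n))
    exact fun ω hω => ⟨hω.1.gram_le, not_le.1 hω.2⟩
  obtain ⟨η, hη, M, hM, key⟩ := CLasso.exists_comparison_bound hmu hC hK
    (show 0 ≤ 3 * A by positivity)
  have hgood := hD.and (hE1.and (hE2.and (hE3.and hE4)))
  set Good : ∀ n, Ω n → Prop := _ with hGood
  change CLasso.HoldsWHP P Good at hgood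
  have hbound : ∀ᶠ n in atTop, ∀ ω, Good n ω →
      |th n ω 1 - b n ω| ≤ M * (Real.log (p n) / n) ∧
      |1 / (n : ℝ) * (CLasso.residX (U n ω) (alpha n (U n ω)) ⬝ᵥ w n ω)| ≤
        M * |b n ω - thetaStar n| + M * (s n * (Real.log (p n) / n)) := by
    filter_upwards [hn0, hlampos, hlamK, hlam1pos, hlam1K, hsl.eventually (ge_mem_nhds hη), hl2]
      with n h1 h2 h3 h4 h5 h6 h7 ω ⟨g1, g2, g3, g4, g5⟩
    rw [hb, ← h7]
    exact key n (p n) (U n ω) (w n ω) (thetaStar n) (gammaStar n) (alpha n (U n ω)) (lamt n ω)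
      (th n ω) (ga n ω) (lam n) (lam1 n) (tau n) (nu n) (s n) (l n) h1 g1 g2 (hl0 n) h2 h3 h4.le h5
      (hs1 n) (by exact_mod_cast hcard n) h6 g4 g3 g5 (hrun n ω)
  have hrate : ∀ᶠ n in atTop, ∀ ω, Good n ω →
      |th n ω 1 - b n ω| ≤ M * (√(s n : ℝ) * Real.log (p n) / n) := by
    filter_upwards [hbound, hlog1] with n h1 h2 ω hω
    refine (h1 ω hω).1.trans (mul_le_mul_of_nonneg_left ?_ hM)
    gcongr
    exact le_mul_of_one_le_left (by linarith) (hss n)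
  refine ⟨fun ε hε => ⟨M, ?_⟩, fun hreg2 => ?_⟩
  · have h1 : Tendsto (fun n => P n {ω | M * (√(s n : ℝ) * Real.log (p n) / n) <
        |th n ω 1 - b n ω|}) atTop (𝓝 0) := by
      refine CLasso.tendsto_measure_mono hgood ?_
      filter_upwards [hrate] with n h ω h2 h3
      exact absurd (h ω h3) (not_le.2 h2)
    filter_upwards [h1.eventually (gt_mem_nhds hε)] with n hn using hn.le
  -- the error of the de-sparsified Lasso is small only if the Gaussian term is small
  have hsmall : CLasso.IsLittleOP P (fun n _ => √(s n : ℝ) * Real.log (p n) / n)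
      (fun n ω => b n ω - thetaStar n) := by
    intro ε hε
    set M' : ℝ := M * (1 / ε) + M with hM'
    have hM'0 : 0 ≤ M' := by positivity
    refine hgood.tendsto_measure (CLasso.tendsto_measure_of_le
      (f := fun n => M' * √C / sigma * ((s n : ℝ) * Real.log (p n) / √n)) ?_ ?_)
    · simpa using hreg2.const_mul (M' * √C / sigma)
    filter_upwards [hbound, hlog1, hn0] with n h1 h2 h3
    have hn' : (0 : ℝ) < n := by exact_mod_cast h3
    have hball := CLasso.measure_noise_small_ball_le (hU n) (hw n) (hind n) hsigma
      (CLasso.measurable_residX (halpha n)) (V := n / C) (ε := M' * (s n * Real.log (p n)))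
      (by positivity)
    refine (measure_mono fun ω hω => ?_).trans (hball.trans
      (ENNReal.ofReal_le_ofReal (le_of_eq ?_)))
    · obtain ⟨g, hω2⟩ := hω
      have hgram := g.1.gram_pos
      have hinv := g.1.gram_inv_le
      refine ⟨?_, ?_⟩
      · have h4 := inv_le_of_inv_le₀ hgram hinv
        rw [one_div, inv_mul_eq_div, le_div_iff₀ hn'] at h4
        rw [div_eq_inv_mul]
        exact h4
      · have h4 := (h1 ω g).2
        have h5 : |b n ω - thetaStar n| ≤ 1 / ε * (s n * (Real.log (p n) / n)) := by
          rw [one_div, inv_mul_eq_div, le_div_iff₀ hε, mul_comm]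
          refine hω2.le.trans ?_
          have h6 : √(s n : ℝ) ≤ s n := by
            refine Real.sqrt_le_iff.2 ⟨by positivity, ?_⟩
            nlinarith [hs1 n]
          rw [abs_of_nonneg (by positivity), ← mul_div_assoc]
          gcongr
        have h6 := mul_le_mul_of_nonneg_left h5 hM
        rw [abs_mul, abs_of_pos (by positivity), one_div, inv_mul_eq_div, div_le_iff₀ hn'] at h4
        refine h4.trans ?_
        have h7 : M' * (s n * Real.log (p n)) =
            (M * (1 / ε * (s n * (Real.log (p n) / n))) + M * (s n * (Real.log (p n) / n))) * n := by
          rw [hM']; field_simp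
        rw [h7]
        exact mul_le_mul_of_nonneg_right (by linarith) hn'.le
    · rw [Real.sqrt_mul (by positivity), Real.sqrt_sq hsigma.le, Real.sqrt_div hn'.le]
      field_simp
  refine ⟨hsmall, fun ε hε => hgood.tendsto_measure ?_⟩
  refine CLasso.tendsto_measure_mono (hsmall (ε / (M + 1)) (by positivity)) ?_
  filter_upwards [hrate, hlog1] with n h1 h2 ω ⟨h3, h4⟩
  have h5 : 0 ≤ √(s n : ℝ) * Real.log (p n) / n := by positivity
  rw [abs_of_nonneg h5, div_mul_eq_mul_div, div_lt_iff₀ (by positivity)]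
  have h6 := h4.trans_le (h1 ω h3)
  linarith
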